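/- Let $B=\{x\in\mathbb{R}^2 : |x|\le 1\}$ and $B^c=\mathbb{R}^2\setminus B$. Let $\Delta_{B^c}$ be the Dirichlet Laplacian on $L^2(B^c)$, i.e. the self-adjoint operator with $u\in D(\Delta_{B^c})$ and $\Delta_{B^c}u=g$ if and only if $u\in H^1_0(B^c)$, $g\in L^2(B^c)$ and $\int_{B^c}\nabla u\cdot\nabla w\,dx=-\int_{B^c} g\,w\,dx$ for all $w\in H^1_0(B^c)$. Let $(e^{t\Delta_{B^c}})_{t\ge 0}$ be the semigroup generated by it, and for $1\le p<\infty$ let $e^{t\Delta_{B^c}}$ on $L^p(B^c)$ be the extension by continuity of its restriction to $L^2(B^c)\cap L^p(B^c)$. Put $d\mu=(1+\log|x|)\,dx$ on $B^c$, let $$\|f\|_{L^p_{d\mu}}=\Big(\int_{B^c}|f(x)|^p(1+\log|x|)\,dx\Big)^{1/p},$$ and let $L^p_{d\mu}$ be the space of all (real- or complex-valued) $f\in L^p(B^c)$ with $\|f\|_{L^p_{d\mu}}<\infty$. For every $p\in[1,\infty)$ and $q\in[p,\infty]$ there exists a constant $C=C_{p,q}>0$ such that for every $f\in L^p_{d\mu}$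 and every $t>0$ the function $e^{t\Delta_{B^c}}f$ is well defined, belongs to $L^q(B^c)$, and satisfies $$\|e^{t\Delta_{B^c}}f\|_{L^q(B^c)}\le\frac{C}{t^{\frac1p-\frac1q}\,(1+\log(1+t))^{\frac1p}}\,\|f\|_{L^p_{d\mu}}$$ (with $1/q=0$ if $q=\infty$). -/

import Mathlib

open MeasureTheory Filter Topology
open scoped ENNReal ContDiff InnerProductSpace

noncomputable section

namespace ExteriorHeat

/-- The Euclidean plane. -/
abbrev Plane : Type := EuclideanSpace ℝ (Fin 2)

/-- The exterior of the closed unit disk. -/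
def exterior : Set Plane := {x | 1 < ‖x‖}

/-- Lebesgue measure on the exterior of the closed unit disk. -/
def extVol : Measure Plane := volume.restrict exterior

/-- The weighted measure `dμ = (1 + log |x|) dx` on the exterior of the closed unit disk. -/
def logMeasure : Measure Plane :=
  extVol.withDensity fun x => ENNReal.ofReal (1 + Real.log ‖x‖)

/-- The Hilbert space `L²` of the exterior domain. -/
abbrev L2 : Type := Lp ℂ 2 extVol

/-- The Hilbert space `L² × (L²)²` of pairs `(u, G)` of a function and a vector field, with
`‖(u, G)‖² = ‖u‖² + ‖G₀‖² + ‖G₁‖²`. On pairs `(u, ∇u)` this is the `H¹` norm. -/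
abbrev L2Jet : Type := WithLp 2 (L2 × PiLp 2 (fun _ : Fin 2 => L2))

/-- `φ` is a smooth function with compact support inside the (open) exterior domain. -/
def IsTestFunction (φ : Plane → ℂ) : Prop :=
  ContDiff ℝ ∞ φ ∧ HasCompactSupport φ ∧ tsupport φ ⊆ exterior

/-- The pairs `(φ, ∇φ)` of a test function and its gradient. -/
def testJets : Set L2Jet :=
  {z | ∃ φ : Plane → ℂ, IsTestFunction φ ∧ z.fst =ᵐ[extVol] φ ∧
    ∀ i : Fin 2, z.snd i =ᵐ[extVol] fun x => fderiv ℝ φ x (EuclideanSpace.single i 1)}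

/-- The Sobolev space `H¹₀` of the exterior domain, the closure of the test functions in the
`H¹` norm; an element `u` is represented by the pair `(u, ∇u)`. -/
def H10 : Submodule ℂ L2Jet := (Submodule.span ℂ testJets).topologicalClosure

instance : CompleteSpace H10 :=
  inferInstanceAs (CompleteSpace (Submodule.span ℂ testJets).topologicalClosure)

/-- The graph of the Dirichlet Laplacian `Δ` on `L²`: `u ∈ H¹₀` and `Δu = g ∈ L²` in the weak
sense, `∫ ∇u · ∇w = - ∫ g w` for all `w ∈ H¹₀`. -/
def IsDirichletLaplacian (u g : L2) : Prop :=
  ∃ z ∈ H10, z.fst = u ∧ ∀ w ∈ H10, ∑ i, ⟪w.snd i, z.snd i⟫_ℂ = -⟪w.fst, g⟫_ℂ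

/-- The resolvent `(1 - Δ)⁻¹` of the Dirichlet Laplacian: `u = (1 - Δ)⁻¹ f` is the element of
`H¹₀` with `⟨w, u⟩ + ⟨∇w, ∇u⟩ = ⟨w, f⟩` for all `w ∈ H¹₀`, so `(u, ∇u)` is the orthogonal
projection of `(f, 0)` to `H¹₀`. See `resolvent_spec` and `eq_resolvent`. -/
def resolvent : L2 →L[ℂ] L2 :=
  WithLp.fstL 2 ℂ L2 (PiLp 2 (fun _ : Fin 2 => L2)) ∘L H10.starProjection ∘L
    ((WithLp.prodContinuousLinearEquiv 2 ℂ L2 (PiLp 2 (fun _ : Fin 2 => L2))).symm :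
      L2 × PiLp 2 (fun _ : Fin 2 => L2) →L[ℂ] L2Jet) ∘L
    ContinuousLinearMap.inl ℂ L2 (PiLp 2 (fun _ : Fin 2 => L2))

/-- The function `s ↦ exp (t (1 - 1/s))`, extended by `0` to `s ≤ 0`. Under `s = 1/(1 - λ)`
it is `λ ↦ exp (t λ)`. -/
def heatSymbol (t s : ℝ) : ℝ := if 0 < s then Real.exp (t * (1 - 1 / s)) else 0

/-- `e^{tA}`, `t > 0`, for a self-adjoint operator `A ≤ 0` on a complex Hilbert space, through the
continuous functional calculus of its resolvent `T = (1 - A)⁻¹`, a self-adjoint operator with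
spectrum in `[0, 1]` and trivial kernel: as `A = 1 - T⁻¹`, `e^{tA}` is the function
`s ↦ exp (t (1 - 1/s))` of `T`. -/
def expOfResolvent {H : Type*} [NormedAddCommGroup H] [InnerProductSpace ℂ H] [CompleteSpace H]
    (T : H →L[ℂ] H) (t : ℝ) : H →L[ℂ] H :=
  cfc (heatSymbol t) T

/-- The Dirichlet heat semigroup `e^{tΔ}`, `t > 0`, on `L²` of the exterior domain. -/
def heatL2 (t : ℝ) : L2 →L[ℂ] L2 := expOfResolvent resolvent t

/-- `v = e^{tΔ} f` for `f ∈ Lᵖ` of the exterior domain, where `e^{tΔ}` on `Lᵖ` is the extension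
by continuity of `e^{tΔ}` on `L² ∩ Lᵖ`: whenever `gₙ ∈ L² ∩ Lᵖ` converges to `f` in `Lᵖ`,
`e^{tΔ} gₙ` converges to `v` in `Lᵖ`. -/
def IsHeatFlow (p : ℝ≥0∞) (t : ℝ) (f v : Plane → ℂ) : Prop :=
  MemLp f p extVol ∧ MemLp v p extVol ∧
    ∀ g : ℕ → L2, (∀ n, MemLp (g n) p extVol) →
      Tendsto (fun n => eLpNorm (⇑(g n) - f) p extVol) atTop (𝓝 0) →
      Tendsto (fun n => eLpNorm (⇑(heatL2 t (g n)) - v) p extVol) atTop (𝓝 0)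

/-! The operators above are what their descriptions say. -/

theorem resolvent_apply (f : L2) :
    resolvent f = (H10.starProjection (WithLp.toLp 2 (f, 0))).fst := rfl

theorem inner_jet (w z : L2Jet) :
    ⟪w, z⟫_ℂ = ⟪w.fst, z.fst⟫_ℂ + ∑ i, ⟪w.snd i, z.snd i⟫_ℂ := by
  rw [WithLp.prod_inner_apply, PiLp.inner_apply]
  rfl

/-- `u = (1 - Δ)⁻¹ f` lies in the domain of `Δ` and `Δu = u - f`. -/
theorem resolvent_spec (f : L2) : IsDirichletLaplacian (resolvent f) (resolvent f - f) := by
  refine ⟨H10.starProjection (WithLp.toLp 2 (f, 0)), Submodule.starProjection_apply_mem _ _,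
    rfl, fun w hw => ?_⟩
  have h := (Submodule.mem_orthogonal _ _).1
    (H10.sub_starProjection_mem_orthogonal (WithLp.toLp 2 (f, 0))) w hw
  rw [inner_sub_right, inner_jet, inner_jet w (H10.starProjection _)] at h
  simp only [WithLp.toLp_fst, WithLp.toLp_snd, PiLp.zero_apply, inner_zero_right,
    Finset.sum_const_zero, add_zero] at h
  rw [inner_sub_right, resolvent_apply]
  linear_combination -h

/-- If `Δu = g` then `u = (1 - Δ)⁻¹ (u - g)`. -/
theorem eq_resolvent {u g : L2} (h : IsDirichletLaplacian u g) : resolvent (u - g) = u := by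
  obtain ⟨z, hz, rfl, hw⟩ := h
  rw [resolvent_apply]
  congr 1
  refine H10.eq_starProjection_of_mem_orthogonal hz ((Submodule.mem_orthogonal _ _).2 ?_)
  intro w hwm
  rw [inner_sub_right, inner_jet, inner_jet w z, hw w hwm]
  simp [inner_sub_right]
  ring

theorem resolvent_isSelfAdjoint : IsSelfAdjoint resolvent := by
  rw [ContinuousLinearMap.isSelfAdjoint_iff_isSymmetric]
  intro f g
  have h := H10.inner_starProjection_left_eq_right (WithLp.toLp 2 (f, 0)) (WithLp.toLp 2 (g, 0))
  rw [inner_jet, inner_jet] at h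
  simpa [resolvent_apply] using h

theorem continuous_heatSymbol {t : ℝ} (ht : 0 < t) : Continuous (heatSymbol t) := by
  have h : heatSymbol t = fun s => Real.exp t * expNegInvGlue (s / t) := by
    funext s
    unfold heatSymbol expNegInvGlue
    by_cases hs : 0 < s
    · rw [if_pos hs, if_neg (not_le.2 (div_pos hs ht)), ← Real.exp_add]
      congr 1
      field_simp
      ring
    · rw [if_neg hs, if_pos (div_nonpos_of_nonpos_of_nonneg (not_lt.1 hs) ht.le), mul_zero]
  rw [h]
  exact continuous_const.mul
    ((expNegInvGlue.contDiff (n := 0)).continuous.comp (continuous_id.div_const t))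

theorem expOfResolvent_add {H : Type*} [NormedAddCommGroup H] [InnerProductSpace ℂ H]
    [CompleteSpace H] (T : H →L[ℂ] H) {s t : ℝ} (hs : 0 < s) (ht : 0 < t) :
    expOfResolvent T (s + t) = expOfResolvent T s * expOfResolvent T t := by
  unfold expOfResolvent
  rw [← cfc_mul _ _ _ (continuous_heatSymbol hs).continuousOn
    (continuous_heatSymbol ht).continuousOn]
  congr 1
  funext r
  unfold heatSymbol
  split_ifs
  · rw [← Real.exp_add, add_mul]
  · simp

end ExteriorHeat

end

noncomputable section

namespace ExteriorHeat

/-! Write $S(t)=e^{t\Delta}$. The logarithmic gain comes from the positive harmonic function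
$\log|x|$ of the exterior domain, which vanishes on the circle and grows at infinity: $S(t)$ does
not increase $\int\log|x|\,|f|\,dx$, while mass that stays near the disk is small because $S(t)f$ is
pointwise small.

Comparison. If $h\ge 0$ is superharmonic and $\mathrm{Re}\,f\le h$, then $\mathrm{Re}\,S(t)f\le h$.
For $u=l(l-\Delta)^{-1}f$ this follows by testing the weak equation with a smooth truncation of
$\mathrm{Re}\,u-h$ (`re_le_barrier`); it passes to $S(t)$ by Euler's formula
$S(t)=\lim(1-t\Delta/n)^{-n}$ (`tendsto_yosida_pow`). Constants $h$ give positivity, $L^\infty$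
contractivity and Jensen's inequality $|S(t)f|^p\le S(t)|f|^p$. By symmetry of $S(t)$, every bounded
$h$ of this kind gives a contraction of $L^1(h\,dx)$ (`lintegral_mul_enorm_le`). Since $\log|x|$ is
unbounded and its gradient is not square integrable, it is replaced by
$h_a=(1-|x|^{-2a})/(2a)\le\log|x|$.

Smoothing. Ladyzhenskaya's inequality gives Nash's inequality, and with $\|\nabla
S(t)g\|^2\le\|g\|^2/t$ this yields $L^1\to L^2$ and, by duality, $L^1\to L^\infty$ bounds, the
latter of order $1/t$ (`exists_enorm_heatL2_le`).

Decay. The $L^1$ norm of $S(t)f$ is split at $|x|=R$. Inside, it is at most $C t^{-1}\pi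
R^2\|f\|_1$; outside, $h_a\ge\frac12\log R$ for $a=1/(2\log R)$, so it is at most $\frac{2}{\log
R}\int h_a|f|$. The choice $R=t^{1/4}$ gives a factor of order $1/\log t$
(`exists_lintegral_enorm_heatL2_le_log`).

For bounded data Jensen's inequality lifts both $L^1$ bounds to $p$-th powers. Half of the time is
spent on decay, half on smoothing, and interpolation between $L^p$ and $L^\infty$ reaches $L^q$.
Truncation and Fatou's lemma extend the result to all $f$. -/

instance : IsFiniteMeasureOnCompacts extVol := by unfold extVol; infer_instance

instance : SigmaFinite extVol := by unfold extVol; infer_instance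

theorem isOpen_exterior : IsOpen exterior := isOpen_lt continuous_const continuous_norm

theorem measurableSet_exterior : MeasurableSet exterior := isOpen_exterior.measurableSet

theorem ae_mem_exterior : ∀ᵐ x ∂extVol, x ∈ exterior := ae_restrict_mem measurableSet_exterior

/-! ### The smooth transition function -/

theorem hasCompactSupport_deriv_smoothTransition :
    HasCompactSupport (deriv Real.smoothTransition) := by
  refine HasCompactSupport.of_support_subset_isCompact (isCompact_Icc (a := (0 : ℝ)) (b := 1)) ?_
  intro s hs
  by_contra hn
  apply hs
  rw [Set.mem_Icc, not_and_or, not_le, not_le] at hn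
  rcases hn with h | h
  · have : Real.smoothTransition =ᶠ[𝓝 s] fun _ => 0 := by
      filter_upwards [Iio_mem_nhds h] with r hr
      exact Real.smoothTransition.zero_of_nonpos (le_of_lt hr)
    rw [this.deriv_eq, deriv_const]
  · have : Real.smoothTransition =ᶠ[𝓝 s] fun _ => 1 := by
      filter_upwards [Ioi_mem_nhds h] with r hr
      exact Real.smoothTransition.one_of_one_le (le_of_lt hr)
    rw [this.deriv_eq, deriv_const]

theorem abs_sub_le_of_abs_deriv_le {f : ℝ → ℝ} {K : ℝ} (hf : Differentiable ℝ f)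
    (h : ∀ x, |deriv f x| ≤ K) (a b : ℝ) : |f a - f b| ≤ K * |a - b| := by
  have := Convex.norm_image_sub_le_of_norm_deriv_le (𝕜 := ℝ) (f := f) (C := K) (s := Set.univ)
    (x := b) (y := a) (fun x _ => hf x) (fun x _ => h x) convex_univ trivial trivial
  simpa using this

theorem smoothTransition_lipschitz : ∃ K : ℝ, 0 ≤ K ∧
    (∀ s, |deriv Real.smoothTransition s| ≤ K) ∧
    (∀ a b, |Real.smoothTransition a - Real.smoothTransition b| ≤ K * |a - b|) ∧
    ∀ a b, |deriv Real.smoothTransition a - deriv Real.smoothTransition b| ≤ K * |a - b| := by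
  have hd : ContDiff ℝ 2 Real.smoothTransition := Real.smoothTransition.contDiff (n := 2)
  have hd1 : ContDiff ℝ 1 (deriv Real.smoothTransition) :=
    ((contDiff_succ_iff_deriv (n := 1)).1 hd).2.2
  obtain ⟨K₁, h₁⟩ := hd1.continuous.bounded_above_of_compact_support
    hasCompactSupport_deriv_smoothTransition
  obtain ⟨K₂, h₂⟩ := (hd1.continuous_deriv le_rfl).bounded_above_of_compact_support
    hasCompactSupport_deriv_smoothTransition.deriv
  have b₁ : ∀ s, |deriv Real.smoothTransition s| ≤ max K₁ K₂ :=
    fun s => (h₁ s).trans (le_max_left _ _)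
  have b₂ : ∀ s, |deriv (deriv Real.smoothTransition) s| ≤ max K₁ K₂ :=
    fun s => (h₂ s).trans (le_max_right _ _)
  exact ⟨max K₁ K₂, (abs_nonneg _).trans (b₁ 0), b₁,
    abs_sub_le_of_abs_deriv_le (hd.differentiable (by norm_num)) b₁,
    abs_sub_le_of_abs_deriv_le (hd1.differentiable (by norm_num)) b₂⟩

theorem deriv_smoothTransition_nonneg (s : ℝ) : 0 ≤ deriv Real.smoothTransition s :=
  Real.smoothTransition.monotone.deriv_nonneg

/-! ### Test functions and their jets -/

/-- The partial derivative in the coordinate direction `i`. -/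
abbrev partialDeriv {F : Type*} [NormedAddCommGroup F] [NormedSpace ℝ F] (i : Fin 2)
    (f : Plane → F) (x : Plane) : F :=
  fderiv ℝ f x (EuclideanSpace.single i 1)

theorem IsTestFunction.memLp {φ : Plane → ℂ} (hφ : IsTestFunction φ) (p : ℝ≥0∞) :
    MemLp φ p extVol :=
  hφ.1.continuous.memLp_of_hasCompactSupport hφ.2.1

theorem IsTestFunction.memLp_partialDeriv {φ : Plane → ℂ} (hφ : IsTestFunction φ) (p : ℝ≥0∞)
    (i : Fin 2) : MemLp (partialDeriv i φ) p extVol := by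
  refine Continuous.memLp_of_hasCompactSupport ?_ ?_
  · exact (hφ.1.continuous_fderiv (by simp)).clm_apply continuous_const
  · exact hφ.2.1.fderiv_apply ℝ _

/-- The pair `(φ, ∇φ)` in `L²`. -/
def IsTestFunction.jet {φ : Plane → ℂ} (hφ : IsTestFunction φ) : L2Jet :=
  WithLp.toLp 2 ((hφ.memLp 2).toLp φ,
    WithLp.toLp 2 fun i => (hφ.memLp_partialDeriv 2 i).toLp (partialDeriv i φ))

theorem IsTestFunction.jet_fst {φ : Plane → ℂ} (hφ : IsTestFunction φ) :
    hφ.jet.fst =ᵐ[extVol] φ := (hφ.memLp 2).coeFn_toLp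

theorem IsTestFunction.jet_snd {φ : Plane → ℂ} (hφ : IsTestFunction φ) (i : Fin 2) :
    hφ.jet.snd i =ᵐ[extVol] partialDeriv i φ := (hφ.memLp_partialDeriv 2 i).coeFn_toLp

theorem IsTestFunction.jet_mem {φ : Plane → ℂ} (hφ : IsTestFunction φ) : hφ.jet ∈ testJets :=
  ⟨φ, hφ, hφ.jet_fst, hφ.jet_snd⟩

theorem testJets_subset_H10 : testJets ⊆ H10 := fun _ hz =>
  Submodule.le_topologicalClosure _ (Submodule.subset_span hz)

/-- Consequently an element of `H10` is a limit of jets of single test functions, to which nonlinear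
truncation can be applied. -/
theorem span_testJets_subset : (Submodule.span ℂ testJets : Set L2Jet) ⊆ testJets := by
  intro z hz
  induction hz using Submodule.span_induction with
  | mem x h => exact h
  | zero =>
    refine ⟨fun _ => 0, ⟨contDiff_const, HasCompactSupport.zero, by simp [tsupport]⟩, ?_, ?_⟩
    · exact Lp.coeFn_zero _ _ _
    · intro i
      filter_upwards [Lp.coeFn_zero ℂ 2 extVol] with a ha
      simpa using ha
  | add x y _ _ hx hy =>
    obtain ⟨φ, hφ, h1, h2⟩ := hx
    obtain ⟨ψ, hψ, k1, k2⟩ := hy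
    refine ⟨φ + ψ, ⟨hφ.1.add hψ.1, hφ.2.1.add hψ.2.1, ?_⟩, ?_, fun i => ?_⟩
    · exact (tsupport_add φ ψ).trans (Set.union_subset hφ.2.2 hψ.2.2)
    · filter_upwards [Lp.coeFn_add x.fst y.fst, h1, k1] with a ha hb hc
      simp only [WithLp.add_fst, ha, Pi.add_apply, hb, hc]
    · filter_upwards [Lp.coeFn_add (x.snd i) (y.snd i), h2 i, k2 i] with a ha hb hc
      rw [fderiv_add (hφ.1.differentiable (by simp) a) (hψ.1.differentiable (by simp) a)]
      simp only [WithLp.add_snd, PiLp.add_apply, ha, Pi.add_apply, hb, hc,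
        _root_.add_apply]
  | smul c x _ hx =>
    obtain ⟨φ, hφ, h1, h2⟩ := hx
    refine ⟨c • φ, ⟨hφ.1.const_smul c, hφ.2.1.smul_left (f := fun _ => c), ?_⟩, ?_, fun i => ?_⟩
    · exact (tsupport_smul_subset_right (fun _ => c) φ).trans hφ.2.2
    · filter_upwards [Lp.coeFn_smul c x.fst, h1] with a ha hb
      simp only [WithLp.smul_fst, ha, Pi.smul_apply, hb]
    · filter_upwards [Lp.coeFn_smul c (x.snd i), h2 i] with a ha hb
      rw [fderiv_const_smul (hφ.1.differentiable (by simp) a)]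
      simp only [WithLp.smul_snd, PiLp.smul_apply, ha, Pi.smul_apply, hb,
        _root_.smul_apply]

theorem isClosed_H10 : IsClosed (H10 : Set L2Jet) := Submodule.isClosed_topologicalClosure _

theorem exists_testJets_tendsto {z : L2Jet} (hz : z ∈ H10) :
    ∃ Z : ℕ → L2Jet, (∀ n, Z n ∈ testJets) ∧ Tendsto Z atTop (𝓝 z) := by
  have hz' : z ∈ closure (Submodule.span ℂ testJets : Set L2Jet) := by
    rw [← Submodule.topologicalClosure_coe]; exact hz
  exact mem_closure_iff_seq_limit.1 (closure_mono span_testJets_subset hz')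

theorem tendsto_fst {Z : ℕ → L2Jet} {z : L2Jet} (h : Tendsto Z atTop (𝓝 z)) :
    Tendsto (fun n => (Z n).fst) atTop (𝓝 z.fst) :=
  ((WithLp.fstL 2 ℂ L2 (PiLp 2 (fun _ : Fin 2 => L2))).continuous.tendsto z).comp h

theorem tendsto_snd {Z : ℕ → L2Jet} {z : L2Jet} (h : Tendsto Z atTop (𝓝 z)) (i : Fin 2) :
    Tendsto (fun n => (Z n).snd i) atTop (𝓝 (z.snd i)) :=
  ((continuous_apply i).tendsto _).comp
    (((PiLp.continuous_ofLp 2 _).tendsto _).comp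
      (((WithLp.sndL 2 ℂ L2 (PiLp 2 (fun _ : Fin 2 => L2))).continuous.tendsto z).comp h))

theorem tendsto_jet {Z : ℕ → L2Jet} {z : L2Jet}
    (h₁ : Tendsto (fun n => (Z n).fst) atTop (𝓝 z.fst))
    (h₂ : ∀ i, Tendsto (fun n => (Z n).snd i) atTop (𝓝 (z.snd i))) :
    Tendsto Z atTop (𝓝 z) := by
  have h₃ : Tendsto (fun n => (Z n).snd) atTop (𝓝 z.snd) :=
    ((PiLp.continuous_toLp 2 _).tendsto _).comp (tendsto_pi_nhds.2 h₂)
  exact (((WithLp.prodContinuousLinearEquiv 2 ℂ L2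
    (PiLp 2 (fun _ : Fin 2 => L2))).symm.continuous.tendsto (z.fst, z.snd)).comp
      (h₁.prodMk_nhds h₃))

theorem exists_subseq_tendsto_ae {F : ℕ → L2} {f : L2} (h : Tendsto F atTop (𝓝 f)) :
    ∃ ns : ℕ → ℕ, StrictMono ns ∧
      ∀ᵐ x ∂extVol, Tendsto (fun n => F (ns n) x) atTop (𝓝 (f x)) :=
  (tendstoInMeasure_of_tendsto_Lp h).exists_seq_tendsto_ae

/-- Convergence in `H¹₀` through test functions, with almost everywhere convergence of the
functions. -/
theorem exists_testJets_tendsto_ae {z : L2Jet} (hz : z ∈ H10) :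
    ∃ Z : ℕ → L2Jet, (∀ n, Z n ∈ testJets) ∧ Tendsto Z atTop (𝓝 z) ∧
      ∀ᵐ x ∂extVol, Tendsto (fun n => (Z n).fst x) atTop (𝓝 (z.fst x)) := by
  obtain ⟨Z, hZ, hlim⟩ := exists_testJets_tendsto hz
  obtain ⟨ns, hns, hae⟩ := exists_subseq_tendsto_ae (tendsto_fst hlim)
  exact ⟨Z ∘ ns, fun n => hZ _, hlim.comp hns.tendsto_atTop, hae⟩

/-! ### Barriers and truncation -/

/-- Nonnegative functions on the plane that are smooth and weakly superharmonic on the exterior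
domain, with square integrable gradient. -/
structure IsBarrier (h : Plane → ℝ) : Prop where
  nonneg : ∀ x, 0 ≤ h x
  smooth : ContDiffOn ℝ ∞ h exterior
  aemeasurable : AEStronglyMeasurable h extVol
  memLp : ∀ i, MemLp (partialDeriv i h) 2 extVol
  superharmonic : ∀ φ : Plane → ℝ, ContDiff ℝ ∞ φ → HasCompactSupport φ →
    tsupport φ ⊆ exterior → (∀ x, 0 ≤ φ x) →
      0 ≤ ∑ i, ∫ x, partialDeriv i h x * partialDeriv i φ x ∂extVol

/-- The gradient of a barrier as a field of complex `L²` functions. -/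
def IsBarrier.grad {h : Plane → ℝ} (hh : IsBarrier h) (i : Fin 2) : L2 :=
  (MemLp.ofReal (K := ℂ) (hh.memLp i)).toLp _

theorem IsBarrier.grad_coe {h : Plane → ℝ} (hh : IsBarrier h) (i : Fin 2) :
    hh.grad i =ᵐ[extVol] fun x => ((partialDeriv i h x : ℝ) : ℂ) :=
  (MemLp.ofReal (K := ℂ) (hh.memLp i)).coeFn_toLp

/-- Barriers and radial fields are regular only on the exterior domain. Anything built from them
that vanishes off a closed subset of that domain is regular on the whole plane. -/
theorem contDiff_of_contDiffAt_exterior {F : Type*} [NormedAddCommGroup F] [NormedSpace ℝ F]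
    {n : WithTop ℕ∞} {K : Set Plane} (hK : IsClosed K) (hKe : K ⊆ exterior) {f : Plane → F}
    (h₀ : ∀ x, x ∉ K → f x = 0) (h₁ : ∀ x ∈ exterior, ContDiffAt ℝ n f x) : ContDiff ℝ n f := by
  rw [contDiff_iff_contDiffAt]
  intro x
  by_cases hx : x ∈ K
  · exact h₁ x (hKe hx)
  · refine contDiffAt_const (c := (0 : F)) |>.congr_of_eventuallyEq ?_
    filter_upwards [hK.isOpen_compl.mem_nhds hx] with y hy using h₀ y hy

section Truncation

variable {h : Plane → ℝ} {φ : Plane → ℂ}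

/-- This is where `h ≥ 0` matters: the truncation inherits the support of `φ` although `h` need not
vanish on the boundary circle. -/
theorem truncation_eq_zero (hh : IsBarrier h) {x : Plane} (hx : x ∉ tsupport φ) :
    Real.smoothTransition ((φ x).re - h x) = 0 := by
  rw [image_eq_zero_of_notMem_tsupport hx]
  exact Real.smoothTransition.zero_of_nonpos (by simpa using hh.nonneg x)

theorem contDiff_truncation (hh : IsBarrier h) (hφ : IsTestFunction φ) :
    ContDiff ℝ ∞ fun x => Real.smoothTransition ((φ x).re - h x) := by
  refine contDiff_of_contDiffAt_exterior (isClosed_tsupport φ) hφ.2.2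
    (fun x hx => truncation_eq_zero hh hx) fun x hx => ?_
  refine (Real.smoothTransition.contDiff (n := ⊤)).contDiffAt.comp x (ContDiffAt.sub ?_ ?_)
  · exact (Complex.reCLM.contDiff.comp hφ.1).contDiffAt
  · exact hh.smooth.contDiffAt (isOpen_exterior.mem_nhds hx)

theorem hasCompactSupport_truncation (hh : IsBarrier h) (hφ : IsTestFunction φ) :
    HasCompactSupport fun x => Real.smoothTransition ((φ x).re - h x) :=
  HasCompactSupport.intro hφ.2.1 fun _ hx => truncation_eq_zero hh hx

theorem tsupport_truncation (hh : IsBarrier h) (hφ : IsTestFunction φ) :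
    tsupport (fun x => Real.smoothTransition ((φ x).re - h x)) ⊆ exterior := by
  refine (closure_minimal ?_ (isClosed_tsupport φ)).trans hφ.2.2
  intro x hx
  by_contra hn
  exact hx (truncation_eq_zero hh hn)

theorem isTestFunction_truncation (hh : IsBarrier h) (hφ : IsTestFunction φ) :
    IsTestFunction fun x => ((Real.smoothTransition ((φ x).re - h x) : ℝ) : ℂ) := by
  refine ⟨Complex.ofRealCLM.contDiff.comp (contDiff_truncation hh hφ),
    (hasCompactSupport_truncation hh hφ).comp_left (g := fun r : ℝ => (r : ℂ)) rfl, ?_⟩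
  refine (closure_mono ?_).trans (tsupport_truncation hh hφ)
  intro x hx hn
  exact hx (by simpa using hn)

theorem partialDeriv_truncation (hh : IsBarrier h) (hφ : IsTestFunction φ) {x : Plane}
    (hx : x ∈ exterior) (i : Fin 2) :
    partialDeriv i (fun x => Real.smoothTransition ((φ x).re - h x)) x =
      deriv Real.smoothTransition ((φ x).re - h x) *
        ((partialDeriv i φ x).re - partialDeriv i h x) := by
  have d₁ : HasFDerivAt h (fderiv ℝ h x) x :=
    ((hh.smooth.contDiffAt (isOpen_exterior.mem_nhds hx)).differentiableAt (by simp)).hasFDerivAt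
  have d₂ : HasFDerivAt φ (fderiv ℝ φ x) x := (hφ.1.differentiable (by simp) x).hasFDerivAt
  have d₃ : HasFDerivAt (fun x => (φ x).re) (Complex.reCLM ∘L fderiv ℝ φ x) x :=
    Complex.reCLM.hasFDerivAt.comp x d₂
  have d₄ : HasDerivAt Real.smoothTransition
      (deriv Real.smoothTransition ((φ x).re - h x)) ((φ x).re - h x) :=
    ((Real.smoothTransition.contDiff (n := 1)).differentiable (by simp) _).hasDerivAt
  have := d₄.comp_hasFDerivAt x (d₃.sub d₁)
  rw [partialDeriv,
    HasFDerivAt.fderiv (f := fun x => Real.smoothTransition ((φ x).re - h x)) this]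
  simp [partialDeriv]

theorem partialDeriv_ofReal {g : Plane → ℝ} (hg : Differentiable ℝ g) (x : Plane) (i : Fin 2) :
    partialDeriv i (fun x => (g x : ℂ)) x = ((partialDeriv i g x : ℝ) : ℂ) := by
  have := Complex.ofRealCLM.hasFDerivAt.comp x (hg x).hasFDerivAt
  rw [partialDeriv, HasFDerivAt.fderiv (f := fun x => (g x : ℂ)) this]
  simp [partialDeriv]

end Truncation

/-- Dominated convergence with majorant $C^2|G|^2$. -/
theorem tendsto_eLpNorm_mul_of_bounded {b : ℕ → Plane → ℝ} {C : ℝ}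
    (hbm : ∀ n, AEStronglyMeasurable (b n) extVol) (hb : ∀ n x, |b n x| ≤ C)
    (hlim : ∀ᵐ x ∂extVol, Tendsto (fun n => b n x) atTop (𝓝 0)) (G : L2) :
    Tendsto (fun n => eLpNorm (fun x => |b n x| * ‖G x‖) 2 extVol) atTop (𝓝 0) := by
  have key : Tendsto (fun n => ∫⁻ x, ‖|b n x| * ‖G x‖‖ₑ ^ (2 : ℝ) ∂extVol) atTop (𝓝 0) := by
    rw [← lintegral_zero (μ := extVol)]
    refine tendsto_lintegral_of_dominated_convergence' (fun x => ENNReal.ofReal C ^ (2 : ℝ) *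
      ‖G x‖ₑ ^ (2 : ℝ)) ?_ ?_ ?_ ?_
    · intro n
      exact ((((hbm n).norm).mul (Lp.aestronglyMeasurable G).norm).enorm).pow_const _
    · intro n
      refine Eventually.of_forall fun x => ?_
      beta_reduce
      rw [← ENNReal.mul_rpow_of_nonneg _ _ (by norm_num)]
      gcongr
      rw [enorm_mul, enorm_norm, Real.enorm_eq_ofReal_abs, abs_abs]
      gcongr
      exact hb n x
    · rw [lintegral_const_mul'' _ ((Lp.aestronglyMeasurable G).enorm.pow_const _)]
      refine ENNReal.mul_ne_top (by simp) ?_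
      have := lintegral_rpow_enorm_lt_top_of_eLpNorm_lt_top (p := 2) (by simp) (by simp)
        (Lp.eLpNorm_lt_top G)
      simpa using this.ne
    · filter_upwards [hlim] with x hx
      have h0 : Tendsto (fun n => |b n x| * ‖G x‖) atTop (𝓝 0) := by
        simpa using (hx.abs).mul_const ‖G x‖
      have h1 := (ENNReal.continuous_rpow_const (y := 2)).continuousAt.tendsto.comp h0.enorm
      simpa [Function.comp_def] using h1
  have h2 : ∀ n, eLpNorm (fun x => |b n x| * ‖G x‖) 2 extVol =
      (∫⁻ x, ‖|b n x| * ‖G x‖‖ₑ ^ (2 : ℝ) ∂extVol) ^ (1 / 2 : ℝ) := by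
    intro n
    rw [eLpNorm_eq_lintegral_rpow_enorm_toReal (by simp) (by simp)]
    simp
  simp_rw [h2]
  have := (ENNReal.continuous_rpow_const (y := 1 / 2)).continuousAt.tendsto.comp key
  simpa [Function.comp_def] using this

/-- The hypothesis is shaped for the chain rule: a factor times an $L^2$-convergent difference, plus
a bounded coefficient tending to zero almost everywhere times a fixed $L^2$ function. -/
theorem tendsto_L2_of_norm_sub_le {F g : ℕ → L2} {f g' G : L2} {K C : ℝ} {b : ℕ → Plane → ℝ}
    (hbm : ∀ n, AEStronglyMeasurable (b n) extVol) (hb : ∀ n x, |b n x| ≤ C)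
    (hlim : ∀ᵐ x ∂extVol, Tendsto (fun n => b n x) atTop (𝓝 0))
    (hg : Tendsto g atTop (𝓝 g'))
    (hle : ∀ n, ∀ᵐ x ∂extVol, ‖F n x - f x‖ ≤ K * ‖g n x - g' x‖ + |b n x| * ‖G x‖) :
    Tendsto F atTop (𝓝 f) := by
  rw [Lp.tendsto_Lp_iff_tendsto_eLpNorm'] at hg ⊢
  have h1 : Tendsto (fun n => ‖K‖ₑ * eLpNorm (⇑(g n) - ⇑g') 2 extVol +
      eLpNorm (fun x => |b n x| * ‖G x‖) 2 extVol) atTop (𝓝 0) := by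
    have := (ENNReal.Tendsto.const_mul hg (Or.inr (enorm_ne_top (x := K)))).add
      (tendsto_eLpNorm_mul_of_bounded hbm hb hlim G)
    simpa using this
  refine tendsto_of_tendsto_of_tendsto_of_le_of_le tendsto_const_nhds h1 (fun _ => zero_le) ?_
  intro n
  have m1 : AEStronglyMeasurable (fun x => K * ‖g n x - g' x‖) extVol :=
    (((Lp.aestronglyMeasurable (g n)).sub (Lp.aestronglyMeasurable g')).norm).const_mul K
  have m2 : AEStronglyMeasurable (fun x => |b n x| * ‖G x‖) extVol :=
    ((hbm n).norm).mul (Lp.aestronglyMeasurable G).norm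
  calc eLpNorm (⇑(F n) - ⇑f) 2 extVol
      ≤ eLpNorm ((fun x => K * ‖g n x - g' x‖) + fun x => |b n x| * ‖G x‖) 2 extVol :=
        eLpNorm_mono_ae_real (hle n)
    _ ≤ _ := eLpNorm_add_le m1 m2 (by norm_num)
    _ = _ := by
      congr 1
      have : (fun x => K * ‖g n x - g' x‖) = K • fun x => ‖(⇑(g n) - ⇑g') x‖ := rfl
      rw [this, eLpNorm_const_smul, eLpNorm_norm]

/-- The truncation `Ψ(Re u - h)` of an element of `H¹₀` over a barrier lies in `H¹₀`. -/
theorem exists_truncation_mem_H10 {h : Plane → ℝ} (hh : IsBarrier h) {z : L2Jet} (hz : z ∈ H10) :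
    ∃ w ∈ H10,
      (w.fst =ᵐ[extVol] fun x => ((Real.smoothTransition ((z.fst x).re - h x) : ℝ) : ℂ)) ∧
      (∀ i, w.snd i =ᵐ[extVol] fun x =>
        ((deriv Real.smoothTransition ((z.fst x).re - h x) *
          ((z.snd i x).re - partialDeriv i h x) : ℝ) : ℂ)) ∧
      0 ≤ ∑ i, RCLike.re ⟪w.snd i, hh.grad i⟫_ℂ := by
  obtain ⟨K, hK0, hK1, hK2, hK3⟩ := smoothTransition_lipschitz
  obtain ⟨Z, hZ, hlim, hae⟩ := exists_testJets_tendsto_ae hz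
  choose φ hφ hφ1 hφ2 using hZ
  have hcont : Continuous (deriv Real.smoothTransition) :=
    (Real.smoothTransition.contDiff (n := 1)).continuous_deriv le_rfl
  have mre : ∀ u : L2, AEStronglyMeasurable (fun x => (u x).re - h x) extVol := fun u =>
    (Complex.continuous_re.comp_aestronglyMeasurable (Lp.aestronglyMeasurable u)).sub
      hh.aemeasurable
  -- the limit
  have mem1 : MemLp (fun x => ((Real.smoothTransition ((z.fst x).re - h x) : ℝ) : ℂ)) 2
      extVol := by
    refine MemLp.of_le_mul (c := K) (Lp.memLp z.fst) ?_ (Eventually.of_forall fun x => ?_)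
    · exact Complex.continuous_ofReal.comp_aestronglyMeasurable
        (Real.smoothTransition.continuous.comp_aestronglyMeasurable (mre _))
    · have h1 := hK2 (z.fst x).re 0
      rw [Real.smoothTransition.zero, sub_zero, sub_zero,
        abs_of_nonneg (Real.smoothTransition.nonneg _)] at h1
      rw [Complex.norm_real, Real.norm_eq_abs, abs_of_nonneg (Real.smoothTransition.nonneg _)]
      calc Real.smoothTransition ((z.fst x).re - h x)
          ≤ Real.smoothTransition (z.fst x).re :=
            Real.smoothTransition.monotone (by linarith [hh.nonneg x])
        _ ≤ K * |(z.fst x).re| := h1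
        _ ≤ _ := by gcongr; exact Complex.abs_re_le_norm _
  have mem2 : ∀ i, MemLp (fun x => (z.snd i x).re - partialDeriv i h x) 2 extVol := fun i =>
    (Lp.memLp (z.snd i)).re.sub (hh.memLp i)
  have mem3 : ∀ i, MemLp (fun x => ((deriv Real.smoothTransition ((z.fst x).re - h x) *
      ((z.snd i x).re - partialDeriv i h x) : ℝ) : ℂ)) 2 extVol := by
    intro i
    refine MemLp.of_le_mul (c := K) (mem2 i) ?_ (Eventually.of_forall fun x => ?_)
    · exact Complex.continuous_ofReal.comp_aestronglyMeasurable
        ((hcont.comp_aestronglyMeasurable (mre _)).mul (mem2 i).aestronglyMeasurable)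
    · rw [Complex.norm_real, norm_mul]
      gcongr
      exact hK1 _
  let w : L2Jet := WithLp.toLp 2 (mem1.toLp _, WithLp.toLp 2 fun i => (mem3 i).toLp _)
  have hw1 : w.fst =ᵐ[extVol] _ := mem1.coeFn_toLp
  have hw2 : ∀ i, w.snd i =ᵐ[extVol] _ := fun i => (mem3 i).coeFn_toLp
  -- the approximants
  let W : ℕ → L2Jet := fun n => (isTestFunction_truncation hh (hφ n)).jet
  have hW1 : ∀ n, (W n).fst =ᵐ[extVol]
      fun x => ((Real.smoothTransition (((Z n).fst x).re - h x) : ℝ) : ℂ) := by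
    intro n
    filter_upwards [(isTestFunction_truncation hh (hφ n)).jet_fst, hφ1 n] with x hx hy
    rw [hx, hy]
  have hdiff : ∀ n, Differentiable ℝ fun x => Real.smoothTransition ((φ n x).re - h x) :=
    fun n => (contDiff_truncation hh (hφ n)).differentiable (by simp)
  have hW2' : ∀ n i, (W n).snd i =ᵐ[extVol] fun x =>
      ((partialDeriv i (fun x => Real.smoothTransition ((φ n x).re - h x)) x : ℝ) : ℂ) := by
    intro n i
    filter_upwards [(isTestFunction_truncation hh (hφ n)).jet_snd i] with x hx
    rw [hx, partialDeriv_ofReal (hdiff n)]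
  have hW2 : ∀ n i, (W n).snd i =ᵐ[extVol] fun x =>
      ((deriv Real.smoothTransition (((Z n).fst x).re - h x) *
        (((Z n).snd i x).re - partialDeriv i h x) : ℝ) : ℂ) := by
    intro n i
    filter_upwards [hW2' n i, hφ1 n, hφ2 n i, ae_mem_exterior] with x hx h1 h2 hxe
    rw [hx, partialDeriv_truncation hh (hφ n) hxe, h1, h2]
  have hWlim : Tendsto W atTop (𝓝 w) := by
    refine tendsto_jet ?_ fun i => ?_
    · refine tendsto_L2_of_norm_sub_le (b := fun _ _ => 0) (C := 0) (G := 0) (K := K)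
        (fun n => aestronglyMeasurable_const) (by simp) (by simp) (tendsto_fst hlim) ?_
      intro n
      filter_upwards [hw1, hW1 n] with x hx hy
      rw [hx, hy, ← Complex.ofReal_sub, Complex.norm_real, abs_zero, zero_mul, add_zero]
      refine (hK2 _ _).trans ?_
      gcongr
      rw [sub_sub_sub_cancel_right, ← Complex.sub_re]
      exact Complex.abs_re_le_norm _
    · refine tendsto_L2_of_norm_sub_le (C := 2 * K) (K := K)
        (b := fun n x => deriv Real.smoothTransition (((Z n).fst x).re - h x) -
          deriv Real.smoothTransition ((z.fst x).re - h x))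
        (G := (MemLp.ofReal (K := ℂ) (mem2 i)).toLp _) ?_ ?_ ?_ (tendsto_snd hlim i) ?_
      · exact fun n => (hcont.comp_aestronglyMeasurable (mre _)).sub
          (hcont.comp_aestronglyMeasurable (mre _))
      · intro n x
        refine (abs_sub _ _).trans ?_
        linarith [hK1 (((Z n).fst x).re - h x), hK1 ((z.fst x).re - h x)]
      · filter_upwards [hae] with x hx
        have h1 : Tendsto (fun n => ((Z n).fst x).re - h x) atTop (𝓝 ((z.fst x).re - h x)) :=
          ((Complex.continuous_re.tendsto _).comp hx).sub_const _
        simpa using ((hcont.tendsto _).comp h1).sub_const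
          (deriv Real.smoothTransition ((z.fst x).re - h x))
      · intro n
        filter_upwards [hw2 i, hW2 n i, (MemLp.ofReal (K := ℂ) (mem2 i)).coeFn_toLp]
          with x hx hy hG
        rw [hx, hy, hG, ← Complex.ofReal_sub, Complex.norm_real, RCLike.norm_ofReal,
          Real.norm_eq_abs]
        set A := deriv Real.smoothTransition (((Z n).fst x).re - h x)
        set B := deriv Real.smoothTransition ((z.fst x).re - h x)
        -- The gradient of the approximant converges strongly and has a bounded coefficient; the
        -- coefficient difference tends to zero only pointwise, but multiplies a fixed function.
        have e : A * (((Z n).snd i x).re - partialDeriv i h x) -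
            B * ((z.snd i x).re - partialDeriv i h x) =
            A * (((Z n).snd i x).re - (z.snd i x).re) +
              (A - B) * ((z.snd i x).re - partialDeriv i h x) := by ring
        rw [e]
        refine (abs_add_le _ _).trans ?_
        rw [abs_mul, abs_mul]
        gcongr
        · exact hK1 _
        · rw [← Complex.sub_re]
          exact Complex.abs_re_le_norm _
  refine ⟨w, isClosed_H10.mem_of_tendsto hWlim (Eventually.of_forall fun n =>
    testJets_subset_H10 (isTestFunction_truncation hh (hφ n)).jet_mem), hw1, hw2, ?_⟩
  -- Superharmonicity is assumed only against nonnegative test functions. The sign survives the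
  -- limit because the gradient of `h` is in $L^2$.
  have hlim2 : Tendsto (fun n => ∑ i, RCLike.re ⟪(W n).snd i, hh.grad i⟫_ℂ) atTop
      (𝓝 (∑ i, RCLike.re ⟪w.snd i, hh.grad i⟫_ℂ)) :=
    tendsto_finsetSum _ fun i _ => (RCLike.continuous_re.tendsto _).comp
      ((tendsto_snd hWlim i).inner tendsto_const_nhds)
  refine ge_of_tendsto' hlim2 fun n => ?_
  refine (hh.superharmonic _ (contDiff_truncation hh (hφ n))
    (hasCompactSupport_truncation hh (hφ n)) (tsupport_truncation hh (hφ n))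
    fun x => Real.smoothTransition.nonneg _).trans_eq (Finset.sum_congr rfl fun i _ => ?_)
  rw [L2.inner_def, ← integral_re (L2.integrable_inner _ _)]
  refine integral_congr_ae ?_
  filter_upwards [hW2' n i, hh.grad_coe i] with x hx hy
  rw [hx, hy]
  simp [partialDeriv]

/-- Comparison principle: `u = λ (λ - Δ)⁻¹ f` satisfies every upper bound of `f` by a barrier. -/
theorem re_le_barrier {h : Plane → ℝ} (hh : IsBarrier h) {z : L2Jet} (hz : z ∈ H10) {l : ℝ}
    (hl : 0 < l) {f : L2}
    (heq : ∀ w ∈ H10, (l : ℂ) * ⟪w.fst, z.fst⟫_ℂ + ∑ i, ⟪w.snd i, z.snd i⟫_ℂ =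
      (l : ℂ) * ⟪w.fst, f⟫_ℂ)
    (hf : ∀ᵐ x ∂extVol, (f x).re ≤ h x) : ∀ᵐ x ∂extVol, (z.fst x).re ≤ h x := by
  obtain ⟨w, hw, hw1, hw2, hw3⟩ := exists_truncation_mem_H10 hh hz
  have e := heq w hw
  -- With $v=\mathrm{Re}\,u-h$ the equation tested with $w=\Psi(v)$ reads
  -- $l\int(\mathrm{Re}\,u-\mathrm{Re}\,f)\Psi(v)+\int\Psi'(v)|\nabla v|^2+\int\nabla h\cdot\nabla
  -- w=0$. All three terms are nonnegative, so the first vanishes.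
  have h1 : l * RCLike.re ⟪w.fst, z.fst - f⟫_ℂ +
      ∑ i, RCLike.re ⟪w.snd i, z.snd i - hh.grad i⟫_ℂ +
      ∑ i, RCLike.re ⟪w.snd i, hh.grad i⟫_ℂ = 0 := by
    have := congrArg Complex.re e
    simp only [Complex.add_re, Complex.re_ofReal_mul, Complex.re_sum] at this
    simp only [inner_sub_right, map_sub, Finset.sum_sub_distrib, RCLike.re_eq_complex_re]
    linarith
  have h2 : 0 ≤ ∑ i, RCLike.re ⟪w.snd i, z.snd i - hh.grad i⟫_ℂ := by
    refine Finset.sum_nonneg fun i _ => ?_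
    rw [L2.inner_def, ← integral_re (L2.integrable_inner _ _)]
    refine integral_nonneg_of_ae ?_
    filter_upwards [hw2 i, hh.grad_coe i, Lp.coeFn_sub (z.snd i) (hh.grad i)] with x hx hy hs
    rw [hx, hs, Pi.sub_apply, hy]
    simp only [RCLike.inner_apply, Complex.conj_ofReal, RCLike.re_eq_complex_re, Pi.zero_apply,
      Complex.re_mul_ofReal, Complex.sub_re, Complex.ofReal_re]
    have := deriv_smoothTransition_nonneg ((z.fst x).re - h x)
    nlinarith [mul_nonneg this (sq_nonneg ((z.snd i x).re - partialDeriv i h x))]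
  have pt : ∀ᵐ x ∂extVol, RCLike.re ⟪w.fst x, (z.fst - f) x⟫_ℂ =
      ((z.fst x).re - (f x).re) * Real.smoothTransition ((z.fst x).re - h x) := by
    filter_upwards [hw1, Lp.coeFn_sub z.fst f] with x hx hs
    rw [hx, hs, Pi.sub_apply]
    simp
  have nn : ∀ᵐ x ∂extVol, 0 ≤ RCLike.re ⟪w.fst x, (z.fst - f) x⟫_ℂ := by
    filter_upwards [pt, hf] with x hx hfx
    rw [hx]
    by_cases hc : (z.fst x).re ≤ h x
    · rw [Real.smoothTransition.zero_of_nonpos (by linarith), mul_zero]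
    · exact mul_nonneg (by linarith) (Real.smoothTransition.nonneg _)
  have int := (L2.integrable_inner w.fst (z.fst - f) (𝕜 := ℂ)).re
  have h3 : RCLike.re ⟪w.fst, z.fst - f⟫_ℂ =
      ∫ x, RCLike.re ⟪w.fst x, (z.fst - f) x⟫_ℂ ∂extVol := by
    rw [L2.inner_def, ← integral_re (L2.integrable_inner _ _)]
  have h4 : ∫ x, RCLike.re ⟪w.fst x, (z.fst - f) x⟫_ℂ ∂extVol = 0 := by
    refine le_antisymm ?_ (integral_nonneg_of_ae nn)
    rw [← h3]
    by_contra hc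
    have := mul_pos hl (not_le.1 hc)
    linarith
  -- Where $\mathrm{Re}\,u>h\ge\mathrm{Re}\,f$ the integrand would be strictly positive, since
  -- $\Psi>0$ on positive arguments.
  rw [integral_eq_zero_iff_of_nonneg_ae nn int] at h4
  filter_upwards [h4, pt, hf] with x hx hy hfx
  by_contra hc
  rw [hy] at hx
  have := mul_pos (show 0 < (z.fst x).re - (f x).re by linarith)
    (Real.smoothTransition.pos_of_pos (show 0 < (z.fst x).re - h x by linarith))
  simp only [Pi.zero_apply] at hx
  linarith

/-! ### Functional calculus of a resolvent -/

/-- The function `s ↦ l / (l - λ)` under `s = 1 / (1 - λ)`. -/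
def yosidaSymbol (l s : ℝ) : ℝ := l * s / (1 + (l - 1) * s)

/-- Put $r=(1+y)e^{-y}\in[1-y^2,1]$. The difference is $(1+y)^{-(2k+1)}(1-r^{2k+1})$, and
Bernoulli's inequality bounds the last factor by $(2k+1)y^2$. Bernoulli again, $(1+y)^k\ge ky$,
absorbs $y^2$ and makes the bound uniform in $y$. -/
theorem inv_one_add_pow_sub_exp_le {y : ℝ} (hy : 0 ≤ y) {k : ℕ} (hk : 0 < k) :
    |(1 / (1 + y)) ^ (2 * k + 1) - Real.exp (-y) ^ (2 * k + 1)| ≤ (2 * k + 1) / (k : ℝ) ^ 2 := by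
  have hk' : (0 : ℝ) < k := by exact_mod_cast hk
  have h1y : 0 < 1 + y := by linarith
  have hb : 0 < Real.exp (-y) := Real.exp_pos _
  have hr : Real.exp (-y) = 1 / (1 + y) * ((1 + y) * Real.exp (-y)) := by field_simp
  set r := (1 + y) * Real.exp (-y) with hrdef
  have hr0 : 0 ≤ r := by positivity
  have hr1 : r ≤ 1 := by
    have h1 : 1 + y ≤ Real.exp y := by linarith [Real.add_one_le_exp y]
    calc r ≤ Real.exp y * Real.exp (-y) := by rw [hrdef]; gcongr
      _ = 1 := by rw [← Real.exp_add]; simp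
  have hr2 : 1 - r ≤ y ^ 2 := by
    have h1 : 1 - y ≤ Real.exp (-y) := by linarith [Real.add_one_le_exp (-y)]
    nlinarith
  have hrn : 1 - r ^ (2 * k + 1) ≤ (2 * k + 1) * y ^ 2 := by
    have := one_add_mul_sub_le_pow (show -1 ≤ r by linarith) (2 * k + 1)
    push_cast at this
    nlinarith
  have ha : (1 / (1 + y)) ^ (2 * k + 1) * y ^ 2 ≤ 1 / (k : ℝ) ^ 2 := by
    have h1 : 1 + (k : ℝ) * y ≤ (1 + y) ^ k := one_add_mul_le_pow (by linarith) k
    have h2 : (k : ℝ) ^ 2 * y ^ 2 ≤ (1 + y) ^ (2 * k + 1) := by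
      calc (k : ℝ) ^ 2 * y ^ 2 = ((k : ℝ) * y) ^ 2 := by ring
        _ ≤ ((1 + y) ^ k) ^ 2 := by gcongr; linarith
        _ = (1 + y) ^ (2 * k) := by rw [← pow_mul, mul_comm]
        _ ≤ (1 + y) ^ (2 * k + 1) := pow_le_pow_right₀ (by linarith) (by lia)
    rw [one_div, inv_pow, ← div_eq_inv_mul, div_le_div_iff₀ (by positivity) (by positivity)]
    linarith
  rw [hr, mul_pow, abs_of_nonneg]
  · calc (1 / (1 + y)) ^ (2 * k + 1) - (1 / (1 + y)) ^ (2 * k + 1) * r ^ (2 * k + 1)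
        = (1 / (1 + y)) ^ (2 * k + 1) * (1 - r ^ (2 * k + 1)) := by ring
      _ ≤ (1 / (1 + y)) ^ (2 * k + 1) * ((2 * k + 1) * y ^ 2) := by gcongr
      _ = (2 * k + 1) * ((1 / (1 + y)) ^ (2 * k + 1) * y ^ 2) := by ring
      _ ≤ (2 * k + 1) * (1 / (k : ℝ) ^ 2) := by gcongr
      _ = _ := by ring
  · have : r ^ (2 * k + 1) ≤ 1 := pow_le_one₀ hr0 hr1
    have h2 : 0 ≤ (1 / (1 + y)) ^ (2 * k + 1) := by positivity
    nlinarith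

theorem yosidaSymbol_pow_sub_heatSymbol_le {t s : ℝ} (ht : 0 < t) (hs : s ∈ Set.Icc (0 : ℝ) 1)
    {k : ℕ} (hk : 0 < k) :
    |yosidaSymbol ((2 * k + 1) / t) s ^ (2 * k + 1) - heatSymbol t s| ≤
      (2 * k + 1) / (k : ℝ) ^ 2 := by
  rcases hs.1.eq_or_lt with h0 | h0
  · subst h0
    simp [yosidaSymbol, heatSymbol]
    positivity
  · have hn : (0 : ℝ) < 2 * k + 1 := by positivity
    have hx : 0 ≤ 1 / s - 1 := by
      rw [sub_nonneg, le_div_iff₀ h0]; linarith [hs.2]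
    set y := t * (1 / s - 1) / (2 * k + 1) with hy
    have hy0 : 0 ≤ y := by positivity
    -- With $s=1/(1-\lambda)$ one has $1/s-1=-\lambda$, so $y=-t\lambda/(2k+1)$.
    have e1 : yosidaSymbol ((2 * k + 1) / t) s = 1 / (1 + y) := by
      have h1 : 1 + ((2 * (k : ℝ) + 1) / t - 1) * s = (2 * k + 1) / t * s * (1 + y) := by
        rw [hy]; field_simp; ring
      rw [yosidaSymbol, h1]
      have : (2 * (k : ℝ) + 1) / t * s ≠ 0 := by positivity
      field_simp
    have e2 : heatSymbol t s = Real.exp (-y) ^ (2 * k + 1) := by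
      rw [heatSymbol, if_pos h0, ← Real.exp_nat_mul]
      congr 1
      rw [hy]
      push_cast
      field_simp
      ring
    rw [e1, e2]
    exact inv_one_add_pow_sub_exp_le hy0 hk

theorem heatSymbol_nonneg (t s : ℝ) : 0 ≤ heatSymbol t s := by
  unfold heatSymbol
  split_ifs <;> positivity

theorem heatSymbol_le_one {t s : ℝ} (ht : 0 < t) (hs : s ≤ 1) : heatSymbol t s ≤ 1 := by
  unfold heatSymbol
  split_ifs with h0
  · rw [Real.exp_le_one_iff]
    have : 1 ≤ 1 / s := by rw [le_div_iff₀ h0]; linarith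
    nlinarith
  · exact zero_le_one

/-- The decay of $e^{-t/s}$ as $s\to0^+$ beats $1/s$. The quotient is the symbol of $(1-A)e^{tA}$,
which is therefore bounded. -/
theorem continuous_heatSymbol_div {t : ℝ} (ht : 0 < t) :
    Continuous fun s => heatSymbol t s / s := by
  have h := (expNegInvGlue.continuous_polynomial_eval_inv_mul Polynomial.X).comp
    (continuous_id.div_const t)
  convert! h.const_mul (Real.exp t / t) using 1
  funext s
  simp only [Function.comp_apply, Polynomial.eval_X, id_eq]
  unfold heatSymbol expNegInvGlue
  by_cases hs : 0 < s
  · rw [if_pos hs, if_neg (not_le.2 (div_pos hs ht))]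
    have : Real.exp (t * (1 - 1 / s)) = Real.exp t * Real.exp (-(s / t)⁻¹) := by
      rw [← Real.exp_add]
      congr 1
      field_simp
      ring
    rw [this]
    field_simp
  · rw [if_neg hs, if_pos (div_nonpos_of_nonpos_of_nonneg (not_lt.1 hs) ht.le)]
    simp

section FunctionalCalculus

variable {H : Type*} [NormedAddCommGroup H] [InnerProductSpace ℂ H] {T : H →L[ℂ] H}

theorem continuousOn_yosidaSymbol (hsp : spectrum ℝ T ⊆ Set.Icc 0 1) {l : ℝ} (hl : 1 ≤ l) :
    ContinuousOn (yosidaSymbol l) (spectrum ℝ T) := by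
  unfold yosidaSymbol
  refine ContinuousOn.div (by fun_prop) (by fun_prop) fun s hs => ?_
  have := hsp hs
  nlinarith [this.1]

variable [CompleteSpace H]

/-- The operator `l (l - A)⁻¹` in terms of `T = (1 - A)⁻¹`. -/
def yosida (T : H →L[ℂ] H) (l : ℝ) : H →L[ℂ] H := cfc (yosidaSymbol l) T

/-- Since $l-A=(1-A)+(l-1)$, the vector $v=l(l-A)^{-1}f$ solves $(1-A)v=lf-(l-1)v$. Being a value of
$T$, it satisfies a weak equation. -/
theorem yosida_eq_apply (hsa : IsSelfAdjoint T)
    (hsp : spectrum ℝ T ⊆ Set.Icc 0 1) {l : ℝ} (hl : 1 ≤ l) (f : H) :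
    yosida T l f = T ((l : ℂ) • f - ((l : ℂ) - 1) • yosida T l f) := by
  have hc := continuousOn_yosidaSymbol hsp hl
  have e : yosida T l + (l - 1) • (T * yosida T l) = l • T := by
    have h1 : cfc (fun s : ℝ => yosidaSymbol l s + (l - 1) * (s * yosidaSymbol l s)) T =
        cfc (fun s : ℝ => l * s) T := by
      refine cfc_congr fun s hs => ?_
      have h0 : 1 + (l - 1) * s ≠ 0 := by nlinarith [(hsp hs).1]
      calc yosidaSymbol l s + (l - 1) * (s * yosidaSymbol l s)
          = yosidaSymbol l s * (1 + (l - 1) * s) := by ring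
        _ = l * s := div_mul_cancel₀ _ h0
    have hid : ContinuousOn (fun s : ℝ => s) (spectrum ℝ T) := continuousOn_id
    have hm : ContinuousOn (fun s : ℝ => s * yosidaSymbol l s) (spectrum ℝ T) := hid.mul hc
    have hm' : ContinuousOn (fun s : ℝ => (l - 1) * (s * yosidaSymbol l s)) (spectrum ℝ T) :=
      hm.const_mul _
    rw [cfc_add T _ _ hc hm', cfc_const_mul _ _ _ hm,
      cfc_mul _ _ _ hid hc, cfc_const_mul _ _ _ hid, cfc_id' ℝ T] at h1
    exact h1
  have e' := congrArg (fun T : H →L[ℂ] H => T f) e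
  simp only [_root_.add_apply, _root_.smul_apply, _root_.mul_apply_eq_comp] at e'
  rw [map_sub, map_smul, map_smul, eq_sub_iff_add_eq]
  rw [← Complex.ofReal_one, ← Complex.ofReal_sub, Complex.coe_smul, Complex.coe_smul]
  exact e'

/-- Euler's formula with $n=2k+1$ and $l=n/t$. It holds in operator norm because the symbols
converge uniformly on $[0,1]$; for $l\ge1$ they have no pole there. -/
theorem tendsto_yosida_pow (hsa : IsSelfAdjoint T)
    (hsp : spectrum ℝ T ⊆ Set.Icc 0 1) {t : ℝ} (ht : 0 < t) :
    Tendsto (fun k : ℕ => yosida T ((2 * k + 1) / t) ^ (2 * k + 1)) atTop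
      (𝓝 (expOfResolvent T t)) := by
  have hlarge : ∀ᶠ k : ℕ in atTop, 1 ≤ (2 * (k : ℝ) + 1) / t := by
    have : Tendsto (fun k : ℕ => (2 * (k : ℝ) + 1) / t) atTop atTop := by
      refine Tendsto.atTop_div_const ht (tendsto_atTop_add_const_right _ _ ?_)
      exact tendsto_natCast_atTop_atTop.const_mul_atTop (by norm_num)
    exact this.eventually_ge_atTop 1
  have hsmall : Tendsto (fun k : ℕ => (2 * (k : ℝ) + 1) / (k : ℝ) ^ 2) atTop (𝓝 0) := by
    have h1 : Tendsto (fun k : ℕ => 2 * (k : ℝ)⁻¹ + (k : ℝ)⁻¹ * (k : ℝ)⁻¹) atTop (𝓝 0) := by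
      have := tendsto_inv_atTop_nhds_zero_nat (𝕜 := ℝ)
      simpa using (this.const_mul 2).add (this.mul this)
    refine h1.congr' ?_
    filter_upwards [eventually_gt_atTop 0] with k hk
    have : (k : ℝ) ≠ 0 := by positivity
    field_simp
  have main : Tendsto (fun k : ℕ => cfc (fun s => yosidaSymbol ((2 * k + 1) / t) s ^ (2 * k + 1))
      T) atTop (𝓝 (cfc (heatSymbol t) T)) := by
    refine tendsto_cfc_fun ?_ ?_
    · rw [Metric.tendstoUniformlyOn_iff]
      intro ε hε
      filter_upwards [hsmall.eventually_lt_const hε, eventually_gt_atTop 0] with k hk hk0 s hs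
      rw [dist_comm, Real.dist_eq]
      exact (yosidaSymbol_pow_sub_heatSymbol_le ht (hsp hs) hk0).trans_lt hk
    · filter_upwards [hlarge] with k hk using (continuousOn_yosidaSymbol hsp hk).pow _
  refine main.congr' ?_
  filter_upwards [hlarge] with k hk
  exact cfc_pow _ _ _ (continuousOn_yosidaSymbol hsp hk) hsa

theorem norm_expOfResolvent_le (hsp : spectrum ℝ T ⊆ Set.Icc 0 1) {t : ℝ} (ht : 0 < t) :
    ‖expOfResolvent T t‖ ≤ 1 := by
  refine norm_cfc_le zero_le_one fun s hs => ?_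
  rw [Real.norm_eq_abs, abs_of_nonneg (heatSymbol_nonneg _ _)]
  exact heatSymbol_le_one ht (hsp hs).2

/-- The operator `(1 - A) e^{tA}`. -/
theorem exists_preimage_expOfResolvent (hsa : IsSelfAdjoint T)
    (hsp : spectrum ℝ T ⊆ Set.Icc 0 1) {t : ℝ} (ht : 0 < t) :
    ∃ G : H →L[ℂ] H, T * G = expOfResolvent T t ∧
      ‖expOfResolvent T t * (G - expOfResolvent T t)‖ ≤ 1 / t := by
  have hQ : ContinuousOn (fun s => heatSymbol t s / s) (spectrum ℝ T) :=
    (continuous_heatSymbol_div ht).continuousOn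
  have hH : ContinuousOn (heatSymbol t) (spectrum ℝ T) :=
    (continuous_heatSymbol ht).continuousOn
  refine ⟨cfc (fun s => heatSymbol t s / s) T, ?_, ?_⟩
  · have hid : ContinuousOn (fun s : ℝ => s) (spectrum ℝ T) := continuousOn_id
    have h1 := cfc_mul (fun s : ℝ => s) (fun s => heatSymbol t s / s) T hid hQ
    rw [cfc_id' ℝ T] at h1
    rw [← h1]
    refine cfc_congr fun s _ => ?_
    by_cases hs : s = 0
    · simp [hs, heatSymbol]
    · field_simp
  -- This operator is $-Ae^{2tA}$; with $x=-\lambda$ its symbol $xe^{-2tx}$ is at most $1/t$.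
  · have : expOfResolvent T t * (cfc (fun s => heatSymbol t s / s) T - expOfResolvent T t) =
        cfc (fun s => heatSymbol t s * (heatSymbol t s / s - heatSymbol t s)) T := by
      have hm : ContinuousOn (fun s => heatSymbol t s / s - heatSymbol t s) (spectrum ℝ T) :=
        hQ.sub hH
      rw [cfc_mul _ _ _ hH hm, cfc_sub _ _ _ hQ hH]
      rfl
    rw [this]
    refine norm_cfc_le (by positivity) fun s hs => ?_
    have hs' := hsp hs
    rcases hs'.1.eq_or_lt with h0 | h0
    · rw [← h0]
      simp [heatSymbol]
      positivity
    · have hx : 0 ≤ 1 / s - 1 := by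
        rw [sub_nonneg, le_div_iff₀ h0]; linarith [hs'.2]
      set x := 1 / s - 1 with hxdef
      have e1 : heatSymbol t s * (heatSymbol t s / s - heatSymbol t s) =
          Real.exp (-(t * x)) * Real.exp (-(t * x)) * x := by
        rw [heatSymbol, if_pos h0, hxdef,
          show t * (1 - 1 / s) = -(t * (1 / s - 1)) by ring]
        ring
      rw [e1, Real.norm_eq_abs, abs_of_nonneg (by positivity), le_div_iff₀ ht]
      have h3 : t * x ≤ Real.exp (t * x) := by linarith [Real.add_one_le_exp (t * x)]
      have h4 : Real.exp (-(t * x)) ≤ 1 := Real.exp_le_one_iff.2 (by nlinarith)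
      have h5 : Real.exp (-(t * x)) * Real.exp (t * x) = 1 := by rw [← Real.exp_add]; simp
      calc Real.exp (-(t * x)) * Real.exp (-(t * x)) * x * t
          = Real.exp (-(t * x)) * (Real.exp (-(t * x)) * (t * x)) := by ring
        _ ≤ 1 * (Real.exp (-(t * x)) * Real.exp (t * x)) := by gcongr
        _ = 1 := by rw [h5, one_mul]

end FunctionalCalculus

/-! ### The heat semigroup as a limit of powers of resolvents -/

theorem exists_mem_H10_resolvent (f : L2) : ∃ z ∈ H10, z.fst = resolvent f ∧
    ∀ w ∈ H10, ∑ i, ⟪w.snd i, z.snd i⟫_ℂ = ⟪w.fst, f - resolvent f⟫_ℂ := by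
  obtain ⟨z, hz, h1, h2⟩ := resolvent_spec f
  refine ⟨z, hz, h1, fun w hw => ?_⟩
  rw [h2 w hw, ← inner_neg_right, neg_sub]

/-- The weak equation for $u=(1-\Delta)^{-1}f$ tested with $u$ gives $\|u\|^2+\|\nabla
u\|^2=\mathrm{Re}\langle u,f\rangle$. Positivity and contractivity of the resolvent both follow. -/
theorem norm_sq_resolvent_le (f : L2) :
    ‖resolvent f‖ ^ 2 ≤ RCLike.re ⟪resolvent f, f⟫_ℂ := by
  obtain ⟨z, hz, h1, h2⟩ := exists_mem_H10_resolvent f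
  have e := congrArg RCLike.re (h2 z hz)
  rw [h1, inner_sub_right, map_sub, inner_self_eq_norm_sq, map_sum] at e
  have : 0 ≤ ∑ i, RCLike.re ⟪z.snd i, z.snd i⟫_ℂ :=
    Finset.sum_nonneg fun i _ => inner_self_nonneg
  linarith

theorem resolvent_nonneg : 0 ≤ resolvent := by
  rw [ContinuousLinearMap.nonneg_iff_isPositive, ContinuousLinearMap.isPositive_def]
  refine ⟨(ContinuousLinearMap.isSelfAdjoint_iff_isSymmetric.1 resolvent_isSelfAdjoint), ?_⟩
  intro f
  exact (sq_nonneg _).trans (norm_sq_resolvent_le f)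

theorem norm_resolvent_le : ‖resolvent‖ ≤ 1 := by
  refine ContinuousLinearMap.opNorm_le_bound _ zero_le_one fun f => ?_
  have h := (norm_sq_resolvent_le f).trans (re_inner_le_norm _ _)
  by_contra hc
  rw [one_mul, not_le] at hc
  nlinarith [norm_nonneg f, norm_nonneg (resolvent f)]

theorem spectrum_resolvent_subset : spectrum ℝ resolvent ⊆ Set.Icc 0 1 := by
  intro s hs
  refine ⟨spectrum_nonneg_of_nonneg resolvent_nonneg hs, ?_⟩
  have h := spectrum.norm_le_norm_mul_of_mem hs
  have h1 : ‖(1 : L2 →L[ℂ] L2)‖ ≤ 1 := ContinuousLinearMap.norm_id_le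
  calc s ≤ ‖s‖ := le_abs_self s
    _ ≤ _ := h
    _ ≤ 1 * 1 := by gcongr; exact norm_resolvent_le
    _ = 1 := one_mul 1

/-- The operator preserves the functions with real part bounded above by `h`. -/
def PreservesBound (T : L2 →L[ℂ] L2) (h : Plane → ℝ) : Prop :=
  ∀ f : L2, (∀ᵐ x ∂extVol, (f x).re ≤ h x) → ∀ᵐ x ∂extVol, (T f x).re ≤ h x

theorem PreservesBound.pow {T : L2 →L[ℂ] L2} {h : Plane → ℝ} (hT : PreservesBound T h) (n : ℕ) :
    PreservesBound (T ^ n) h := by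
  induction n with
  | zero => exact fun f hf => by simpa using hf
  | succ n ih =>
    intro f hf
    rw [pow_succ, _root_.mul_apply_eq_comp]
    exact ih _ (hT f hf)

/-- Norm convergence gives $L^2$ convergence, hence almost everywhere convergence along a
subsequence, which keeps pointwise bounds. -/
theorem PreservesBound.of_tendsto {T : ℕ → L2 →L[ℂ] L2} {S : L2 →L[ℂ] L2} {h : Plane → ℝ}
    (hT : ∀ᶠ n in atTop, PreservesBound (T n) h) (hlim : Tendsto T atTop (𝓝 S)) :
    PreservesBound S h := by
  intro f hf
  have hlim' : Tendsto (fun n => T n f) atTop (𝓝 (S f)) :=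
    ((ContinuousLinearMap.apply ℂ L2 f).continuous.tendsto S).comp hlim
  obtain ⟨ns, hns, hae⟩ := exists_subseq_tendsto_ae hlim'
  obtain ⟨N, hN⟩ := eventually_atTop.1 hT
  have hall : ∀ᵐ x ∂extVol, ∀ n, N ≤ n → (T n f x).re ≤ h x := by
    rw [ae_all_iff]
    intro n
    by_cases hn : N ≤ n
    · filter_upwards [hN n hn f hf] with x hx using fun _ => hx
    · exact Eventually.of_forall fun x hx => absurd hx hn
  filter_upwards [hae, hall] with x hx hx'
  refine le_of_tendsto ((Complex.continuous_re.tendsto _).comp hx) ?_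
  filter_upwards [eventually_ge_atTop N] with n hn
  exact hx' _ (hn.trans (hns.id_le n))

theorem preservesBound_yosida {l : ℝ} (hl : 1 ≤ l) {h : Plane → ℝ} (hh : IsBarrier h) :
    PreservesBound (yosida resolvent l) h := by
  intro f hf
  obtain ⟨z, hz, h1, h2⟩ :=
    exists_mem_H10_resolvent ((l : ℂ) • f - ((l : ℂ) - 1) • yosida resolvent l f)
  rw [← yosida_eq_apply resolvent_isSelfAdjoint spectrum_resolvent_subset hl] at h1 h2
  rw [← h1]
  refine re_le_barrier hh hz (lt_of_lt_of_le one_pos hl) (fun w hw => ?_) hf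
  rw [h2 w hw, h1]
  simp only [inner_sub_right, inner_smul_right]
  ring

theorem preservesBound_heatL2 {t : ℝ} (ht : 0 < t) {h : Plane → ℝ} (hh : IsBarrier h) :
    PreservesBound (heatL2 t) h := by
  refine PreservesBound.of_tendsto ?_ (tendsto_yosida_pow resolvent_isSelfAdjoint
    spectrum_resolvent_subset ht)
  have : Tendsto (fun k : ℕ => (2 * (k : ℝ) + 1) / t) atTop atTop := by
    refine Tendsto.atTop_div_const ht (tendsto_atTop_add_const_right _ _ ?_)
    exact tendsto_natCast_atTop_atTop.const_mul_atTop (by norm_num)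
  filter_upwards [this.eventually_ge_atTop 1] with k hk using (preservesBound_yosida hk hh).pow _

/-! ### Spectral estimates for the heat semigroup -/

theorem isSelfAdjoint_heatL2 (t : ℝ) : IsSelfAdjoint (heatL2 t) := cfc_predicate _ _

theorem inner_heatL2_left (t : ℝ) (f g : L2) : ⟪heatL2 t f, g⟫_ℂ = ⟪f, heatL2 t g⟫_ℂ :=
  ContinuousLinearMap.isSelfAdjoint_iff_isSymmetric.1 (isSelfAdjoint_heatL2 t) f g

theorem heatL2_add {s t : ℝ} (hs : 0 < s) (ht : 0 < t) (f : L2) :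
    heatL2 (s + t) f = heatL2 s (heatL2 t f) := by
  unfold heatL2
  rw [expOfResolvent_add _ hs ht]
  rfl

theorem heatL2_half {t : ℝ} (ht : 0 < t) (f : L2) :
    heatL2 t f = heatL2 (t / 2) (heatL2 (t / 2) f) := by
  rw [← heatL2_add (half_pos ht) (half_pos ht), add_halves]

theorem norm_heatL2_le {t : ℝ} (ht : 0 < t) (f : L2) : ‖heatL2 t f‖ ≤ ‖f‖ := by
  have h : ‖heatL2 t‖ ≤ 1 := norm_expOfResolvent_le spectrum_resolvent_subset ht
  calc ‖heatL2 t f‖ ≤ ‖heatL2 t‖ * ‖f‖ := (heatL2 t).le_opNorm f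
    _ ≤ 1 * ‖f‖ := by gcongr
    _ = ‖f‖ := one_mul _

/-- The smoothing estimate `‖∇ e^{tΔ} g‖² ≤ ‖g‖² / t`. -/
theorem exists_mem_H10_heatL2 {t : ℝ} (ht : 0 < t) (g : L2) :
    ∃ z ∈ H10, z.fst = heatL2 t g ∧ ∑ i, ‖z.snd i‖ ^ 2 ≤ ‖g‖ ^ 2 / t := by
  obtain ⟨G, hRG, hop⟩ := exists_preimage_expOfResolvent resolvent_isSelfAdjoint
    spectrum_resolvent_subset ht
  change resolvent * G = heatL2 t at hRG
  change ‖heatL2 t * (G - heatL2 t)‖ ≤ 1 / t at hop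
  obtain ⟨z, hz, h1, h2⟩ := exists_mem_H10_resolvent (G g)
  have hRG' : resolvent (G g) = heatL2 t g := by rw [← hRG]; rfl
  rw [hRG'] at h1 h2
  refine ⟨z, hz, h1, ?_⟩
  -- Testing with $z$ itself: $\|\nabla S(t)g\|^2=\langle S(t)g,-\Delta S(t)g\rangle=\langle
  -- g,-\Delta S(2t)g\rangle$.
  have e := congrArg RCLike.re (h2 z hz)
  rw [map_sum, h1, inner_heatL2_left] at e
  simp only [inner_self_eq_norm_sq] at e
  rw [e]
  calc RCLike.re ⟪g, heatL2 t (G g - heatL2 t g)⟫_ℂ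
      ≤ ‖g‖ * ‖heatL2 t (G g - heatL2 t g)‖ := re_inner_le_norm _ _
    _ = ‖g‖ * ‖(heatL2 t * (G - heatL2 t)) g‖ := rfl
    _ ≤ ‖g‖ * (1 / t * ‖g‖) := by
      gcongr
      exact (ContinuousLinearMap.le_opNorm _ _).trans (by gcongr)
    _ = ‖g‖ ^ 2 / t := by ring

/-! ### Examples of barriers -/

theorem isBarrier_const {c : ℝ} (hc : 0 ≤ c) : IsBarrier fun _ => c where
  nonneg _ := hc
  smooth := contDiffOn_const
  aemeasurable := aestronglyMeasurable_const
  memLp i := by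
    have : partialDeriv i (fun _ : Plane => c) = fun _ => 0 := by
      funext x
      simp [partialDeriv]
    rw [this]
    exact MemLp.zero'
  superharmonic φ _ _ _ _ := by simp [partialDeriv]

/-- The field `|x|^{2r} xᵢ`. -/
def radialField (r : ℝ) (i : Fin 2) (x : Plane) : ℝ := (‖x‖ ^ 2) ^ r * x i

theorem hasFDerivAt_normSq_rpow {x : Plane} (hx : x ≠ 0) (r : ℝ) :
    HasFDerivAt (fun y : Plane => (‖y‖ ^ 2) ^ r)
      ((r * (‖x‖ ^ 2) ^ (r - 1)) • ((2 : ℝ) • innerSL ℝ x)) x := by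
  have h1 : HasFDerivAt (fun y : Plane => ‖y‖ ^ 2) ((2 : ℝ) • innerSL ℝ x) x := by
    have := (hasStrictFDerivAt_norm_sq x).hasFDerivAt
    rwa [← Nat.cast_smul_eq_nsmul ℝ 2, Nat.cast_ofNat] at this
  have h2 : ‖x‖ ^ 2 ≠ 0 := by positivity
  exact (Real.hasDerivAt_rpow_const (p := r) (Or.inl h2)).comp_hasFDerivAt x h1

theorem contDiffAt_normSq_rpow {x : Plane} (hx : x ≠ 0) (r : ℝ) :
    ContDiffAt ℝ ∞ (fun y : Plane => (‖y‖ ^ 2) ^ r) x := by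
  have h2 : ‖x‖ ^ 2 ≠ 0 := by positivity
  exact (Real.contDiffAt_rpow_const_of_ne h2).comp x (contDiff_norm_sq ℝ).contDiffAt

theorem contDiffAt_radialField {x : Plane} (hx : x ≠ 0) (r : ℝ) (i : Fin 2) :
    ContDiffAt ℝ ∞ (radialField r i) x :=
  (contDiffAt_normSq_rpow hx r).mul (EuclideanSpace.proj (𝕜 := ℝ) i).contDiff.contDiffAt

theorem ne_zero_of_mem_exterior {x : Plane} (hx : x ∈ exterior) : x ≠ 0 := by
  rintro rfl
  simp [exterior] at hx
  linarith

theorem partialDeriv_normSq_rpow {x : Plane} (hx : x ≠ 0) (r : ℝ) (i : Fin 2) :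
    partialDeriv i (fun y : Plane => (‖y‖ ^ 2) ^ r) x = 2 * r * radialField (r - 1) i x := by
  rw [partialDeriv, (hasFDerivAt_normSq_rpow hx r).fderiv]
  simp [radialField, EuclideanSpace.inner_single_right]
  ring

theorem divergence_radialField {x : Plane} (hx : x ≠ 0) (r : ℝ) :
    ∑ i, partialDeriv i (radialField r i) x = 2 * (r + 1) * (‖x‖ ^ 2) ^ r := by
  have h : ∀ i, partialDeriv i (radialField r i) x =
      (‖x‖ ^ 2) ^ r + 2 * r * (‖x‖ ^ 2) ^ (r - 1) * x i ^ 2 := by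
    intro i
    have d := (hasFDerivAt_normSq_rpow hx r).mul
      ((EuclideanSpace.proj (𝕜 := ℝ) i : Plane →L[ℝ] ℝ).hasFDerivAt (x := x))
    rw [partialDeriv, HasFDerivAt.fderiv (f := radialField r i) d]
    simp [EuclideanSpace.inner_single_right]
    ring
  have h2 : (‖x‖ ^ 2) ^ r = (‖x‖ ^ 2) ^ (r - 1) * ‖x‖ ^ 2 := by
    have : 0 < ‖x‖ ^ 2 := by positivity
    rw [← Real.rpow_add_one this.ne']
    congr 1
    ring
  simp only [h, Fin.sum_univ_two]
  rw [h2, EuclideanSpace.real_norm_sq_eq, Fin.sum_univ_two]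
  ring

/-- The superharmonic function `(1 - |x|^{-2a}) / (2a)` on the exterior of the unit disk, which
increases to `log |x|` as `a → 0`. -/
def powBarrier (a : ℝ) (x : Plane) : ℝ :=
  if 1 < ‖x‖ then (1 - (‖x‖ ^ 2) ^ (-a)) / (2 * a) else 0

theorem powBarrier_eventuallyEq (a : ℝ) {x : Plane} (hx : x ∈ exterior) :
    powBarrier a =ᶠ[𝓝 x] fun y => (1 - (‖y‖ ^ 2) ^ (-a)) / (2 * a) := by
  filter_upwards [isOpen_exterior.mem_nhds hx] with y hy
  exact if_pos hy

theorem partialDeriv_powBarrier {a : ℝ} (ha : 0 < a) {x : Plane} (hx : x ∈ exterior)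
    (i : Fin 2) : partialDeriv i (powBarrier a) x = radialField (-a - 1) i x := by
  have hx0 := ne_zero_of_mem_exterior hx
  have h1 := partialDeriv_normSq_rpow hx0 (-a) i
  rw [partialDeriv, (powBarrier_eventuallyEq a hx).fderiv_eq]
  have h2 : HasFDerivAt (fun y : Plane => (1 - (‖y‖ ^ 2) ^ (-a)) / (2 * a)) _ x :=
    ((hasFDerivAt_normSq_rpow hx0 (-a)).const_sub 1).mul_const (2 * a)⁻¹
  rw [h2.fderiv]
  rw [partialDeriv, (hasFDerivAt_normSq_rpow hx0 (-a)).fderiv] at h1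
  rw [_root_.smul_apply, _root_.neg_apply, h1, smul_eq_mul]
  field_simp

theorem powBarrier_nonneg {a : ℝ} (ha : 0 < a) (x : Plane) : 0 ≤ powBarrier a x := by
  unfold powBarrier
  split_ifs with h
  · have : (‖x‖ ^ 2) ^ (-a) ≤ 1 :=
      Real.rpow_le_one_of_one_le_of_nonpos (one_le_pow₀ h.le) (by linarith)
    exact div_nonneg (by linarith) (by linarith)
  · exact le_rfl

theorem measurable_powBarrier (a : ℝ) : Measurable (powBarrier a) :=
  Measurable.ite measurableSet_exterior
    ((measurable_const.sub ((measurable_norm.pow_const 2).pow_const _)).div_const _)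
    measurable_const

/-- The field has length $|x|^{-2a-1}$, whose square is integrable at infinity in the plane exactly
for $a>0$. This is why $\log|x|$, the case $a=0$, needs regularizing. -/
theorem memLp_radialField {a : ℝ} (ha : 0 < a) (i : Fin 2) :
    MemLp (radialField (-a - 1) i) 2 extVol := by
  have hm : AEStronglyMeasurable (radialField (-a - 1) i) extVol := by
    refine Measurable.aestronglyMeasurable ?_
    exact (((measurable_norm.pow_const 2).pow_const _).mul
      (EuclideanSpace.proj (𝕜 := ℝ) i : Plane →L[ℝ] ℝ).continuous.measurable)
  have hg : MemLp (fun x : Plane => (1 + ‖x‖) ^ (-(2 * a + 1))) 2 extVol := by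
    have hm' : Measurable fun x : Plane => (1 + ‖x‖) ^ (-(2 * a + 1)) :=
      (measurable_const.add measurable_norm).pow_const _
    rw [memLp_two_iff_integrable_sq hm'.aestronglyMeasurable]
    have h := integrable_one_add_norm (E := Plane) (μ := volume) (r := 2 * (2 * a + 1))
      (by simp; linarith)
    refine (h.mono_measure Measure.restrict_le_self).congr (Eventually.of_forall fun x => ?_)
    have : 0 ≤ 1 + ‖x‖ := by positivity
    beta_reduce
    rw [← Real.rpow_natCast, ← Real.rpow_mul this]
    congr 1
    push_cast
    ring
  refine hg.of_le_mul (c := 2 ^ (2 * a + 1)) hm ?_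
  filter_upwards [ae_mem_exterior] with x hx
  have hx1 : 1 < ‖x‖ := hx
  have hx0 : 0 < ‖x‖ := by linarith
  have h1 : |x i| ≤ ‖x‖ := PiLp.norm_apply_le x i
  have h2 : ‖radialField (-a - 1) i x‖ ≤ ‖x‖ ^ (-(2 * a + 1)) := by
    rw [radialField, norm_mul, Real.norm_eq_abs, Real.norm_eq_abs, abs_of_nonneg (by positivity)]
    calc (‖x‖ ^ 2) ^ (-a - 1) * |x i| ≤ (‖x‖ ^ 2) ^ (-a - 1) * ‖x‖ := by gcongr
      _ = ‖x‖ ^ (-(2 * a + 1)) := by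
        rw [← Real.rpow_natCast, ← Real.rpow_mul hx0.le, ← Real.rpow_add_one hx0.ne']
        congr 1
        push_cast
        ring
  refine h2.trans ?_
  have h3 : 0 < 1 + ‖x‖ := by linarith
  rw [Real.norm_eq_abs, abs_of_nonneg (by positivity)]
  calc ‖x‖ ^ (-(2 * a + 1)) ≤ ((1 + ‖x‖) / 2) ^ (-(2 * a + 1)) :=
        Real.rpow_le_rpow_of_nonpos (by positivity) (by linarith) (by linarith)
    _ = 2 ^ (2 * a + 1) * (1 + ‖x‖) ^ (-(2 * a + 1)) := by
      rw [Real.div_rpow h3.le (by norm_num), Real.rpow_neg (by norm_num : (0 : ℝ) ≤ 2),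
        div_inv_eq_mul, mul_comm]

theorem integrable_of_exterior {f φ : Plane → ℝ} (hφ : HasCompactSupport φ)
    (hφe : tsupport φ ⊆ exterior) (h₀ : ∀ x, x ∉ tsupport φ → f x = 0)
    (h₁ : ∀ x ∈ exterior, ContDiffAt ℝ 0 f x) : Integrable f :=
  (contDiff_of_contDiffAt_exterior (isClosed_tsupport φ) hφe h₀ h₁).continuous
    |>.integrable_of_hasCompactSupport (HasCompactSupport.intro hφ h₀)

/-- The gradient $x|x|^{-2a-2}$ has divergence $-2a|x|^{-2a-2}\le0$; integration by parts against
$\varphi\ge0$ gives the sign. -/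
theorem isBarrier_powBarrier {a : ℝ} (ha : 0 < a) : IsBarrier (powBarrier a) where
  nonneg := powBarrier_nonneg ha
  smooth x hx := by
    refine ContDiffAt.contDiffWithinAt ?_
    refine ContDiffAt.congr_of_eventuallyEq ?_ (powBarrier_eventuallyEq a hx)
    exact (contDiffAt_const.sub
      (contDiffAt_normSq_rpow (ne_zero_of_mem_exterior hx) (-a))).div_const _
  aemeasurable := (measurable_powBarrier a).aestronglyMeasurable
  memLp i := by
    refine (memLp_radialField ha i).ae_eq ?_
    filter_upwards [ae_mem_exterior] with x hx using (partialDeriv_powBarrier ha hx i).symm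
  superharmonic φ hφ hφc hφe hφ0 := by
    set r := -a - 1 with hr
    have hz : ∀ i x, x ∉ tsupport φ → partialDeriv i φ x = 0 := by
      intro i x hx
      have := image_eq_zero_of_notMem_tsupport (fun h => hx (tsupport_fderiv_subset ℝ h))
      rw [partialDeriv, this]
      rfl
    have hdφ : ∀ i x, ContDiffAt ℝ 0 (partialDeriv i φ) x := fun i x =>
      ((hφ.fderiv_right (m := 0) (by simp)).clm_apply contDiff_const).contDiffAt
    have hdg : ∀ i, ∀ x ∈ exterior, ContDiffAt ℝ 0 (partialDeriv i (radialField r i)) x :=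
      fun i x hx => ((contDiffAt_radialField (ne_zero_of_mem_exterior hx) r i).fderiv_right
        (m := 0) (by simp)).clm_apply contDiffAt_const
    have hg : ∀ i, ∀ x ∈ exterior, ContDiffAt ℝ 0 (radialField r i) x := fun i x hx =>
      (contDiffAt_radialField (ne_zero_of_mem_exterior hx) r i).of_le (by simp)
    have hφ' : ∀ x, ContDiffAt ℝ 0 φ x := fun x => hφ.contDiffAt.of_le (by simp)
    have i1 : ∀ i, Integrable fun x => partialDeriv i (radialField r i) x * φ x := fun i =>
      integrable_of_exterior hφc hφe
        (fun x hx => by rw [image_eq_zero_of_notMem_tsupport hx, mul_zero])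
        (fun x hx => (hdg i x hx).mul (hφ' x))
    have i2 : ∀ i, Integrable fun x => radialField r i x * partialDeriv i φ x := fun i =>
      integrable_of_exterior hφc hφe (fun x hx => by rw [hz i x hx, mul_zero])
        (fun x hx => (hg i x hx).mul (hdφ i x))
    have i3 : ∀ i, Integrable fun x => radialField r i x * φ x := fun i =>
      integrable_of_exterior hφc hφe
        (fun x hx => by rw [image_eq_zero_of_notMem_tsupport hx, mul_zero])
        (fun x hx => (hg i x hx).mul (hφ' x))
    have key : ∀ i, ∫ x, partialDeriv i (powBarrier a) x * partialDeriv i φ x ∂extVol =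
        -∫ x, partialDeriv i (radialField r i) x * φ x := by
      intro i
      have ibp := integral_mul_fderiv_eq_neg_fderiv_mul_of_integrable (i1 i) (i2 i) (i3 i)
        (fun x hx => (contDiffAt_radialField (ne_zero_of_mem_exterior (hφe hx)) r
          i).differentiableAt (by simp)) (fun x _ => hφ.differentiable (by simp) x)
      rw [← ibp, ← setIntegral_eq_integral_of_forall_compl_eq_zero (s := exterior)
        (f := fun x => radialField r i x * fderiv ℝ φ x (EuclideanSpace.single i 1))]
      · refine setIntegral_congr_fun measurableSet_exterior fun x hx => ?_
        beta_reduce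
        rw [partialDeriv_powBarrier ha hx]
      · intro x hx
        rw [show fderiv ℝ φ x (EuclideanSpace.single i 1) = 0 from hz i x fun h => hx (hφe h),
          mul_zero]
    rw [Finset.sum_congr rfl fun i _ => key i, Finset.sum_neg_distrib,
      ← integral_finsetSum _ fun i _ => i1 i, ← integral_neg]
    refine integral_nonneg fun x => ?_
    simp only [Pi.zero_apply]
    rw [← Finset.sum_mul]
    by_cases hx : x ∈ tsupport φ
    · rw [divergence_radialField (ne_zero_of_mem_exterior (hφe hx))]
      have h1 : 0 ≤ (‖x‖ ^ 2) ^ r := by positivity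
      have h2 : 0 ≤ (‖x‖ ^ 2) ^ r * φ x := mul_nonneg h1 (hφ0 x)
      have h3 : r + 1 = -a := by rw [hr]; ring
      rw [h3]
      nlinarith
    · simp [image_eq_zero_of_notMem_tsupport hx]

/-- This is $1-e^{-y}\le y$ with $y=2a\log|x|$. -/
theorem powBarrier_le_log {a : ℝ} (ha : 0 < a) {x : Plane} (hx : x ∈ exterior) :
    powBarrier a x ≤ Real.log ‖x‖ := by
  have hx0 : 0 < ‖x‖ := norm_pos_iff.2 (ne_zero_of_mem_exterior hx)
  have hx1 : 1 < ‖x‖ := hx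
  rw [powBarrier, if_pos hx1, div_le_iff₀ (by positivity), Real.rpow_def_of_pos (by positivity),
    Real.log_pow]
  have := Real.add_one_le_exp (((2 : ℕ) : ℝ) * Real.log ‖x‖ * -a)
  push_cast at this ⊢
  linarith

/-- With `a = 1 / (2 log R)` the barrier is comparable with `log R` at distance `R`. -/
theorem half_log_le_powBarrier {R : ℝ} (hR : 1 < R) {x : Plane} (hx : R ≤ ‖x‖) :
    Real.log R / 2 ≤ powBarrier (1 / (2 * Real.log R)) x := by
  have hl : 0 < Real.log R := Real.log_pos hR
  have h1 : (‖x‖ ^ 2) ^ (-(1 / (2 * Real.log R))) ≤ 1 / 2 := by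
    calc (‖x‖ ^ 2) ^ (-(1 / (2 * Real.log R))) ≤ (R ^ 2) ^ (-(1 / (2 * Real.log R))) :=
          Real.rpow_le_rpow_of_nonpos (by positivity) (by gcongr)
            (by rw [neg_nonpos]; positivity)
      _ = Real.exp (-1) := by
        rw [Real.rpow_def_of_pos (by positivity), Real.log_pow]
        congr 1
        field_simp
        norm_num
      _ ≤ 1 / 2 := by
        rw [Real.exp_neg, one_div]
        gcongr
        linarith [Real.add_one_le_exp (1 : ℝ)]
  rw [powBarrier, if_pos (lt_of_lt_of_le hR hx), le_div_iff₀ (by positivity)]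
  have : Real.log R / 2 * (2 * (1 / (2 * Real.log R))) = 1 / 2 := by field_simp
  rw [this]
  linarith

/-! ### Sub-Markovian operators -/

theorem exists_circle_mul_re_eq_norm (w : ℂ) : ∃ c : Circle, ((c : ℂ) * w).re = ‖w‖ := by
  refine ⟨Circle.exp (-Complex.arg w), ?_⟩
  conv_lhs => rw [← Complex.norm_mul_exp_arg_mul_I w]
  rw [Circle.coe_exp, mul_left_comm, ← Complex.exp_add]
  simp

/-- Countably many rotations suffice to recover the modulus from real parts, so the exceptional null
sets of the rotated inequalities can be united. -/
theorem norm_le_of_forall_denseSeq {w : ℂ} {r : ℝ}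
    (h : ∀ n, (((TopologicalSpace.denseSeq Circle n : Circle) : ℂ) * w).re ≤ r) : ‖w‖ ≤ r := by
  have hcl : IsClosed {c : Circle | ((c : ℂ) * w).re ≤ r} :=
    isClosed_le (Complex.continuous_re.comp (continuous_subtype_val.mul continuous_const))
      continuous_const
  have huniv : {c : Circle | ((c : ℂ) * w).re ≤ r} = Set.univ := by
    rw [← hcl.closure_eq]
    refine Dense.closure_eq ((TopologicalSpace.denseRange_denseSeq Circle).mono ?_)
    rintro _ ⟨n, rfl⟩
    exact h n
  obtain ⟨c, hc⟩ := exists_circle_mul_re_eq_norm w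
  have : c ∈ {c : Circle | ((c : ℂ) * w).re ≤ r} := huniv ▸ Set.mem_univ c
  rw [← hc]
  exact this

/-- A positivity preserving operator preserves domination. -/
theorem PreservesBound.norm_le {T : L2 →L[ℂ] L2} (hT : PreservesBound T fun _ => 0) {f g : L2}
    (hfg : ∀ᵐ x ∂extVol, ‖f x‖ ≤ (g x).re) : ∀ᵐ x ∂extVol, ‖T f x‖ ≤ (T g x).re := by
  have h : ∀ n, ∀ᵐ x ∂extVol,
      (((TopologicalSpace.denseSeq Circle n : Circle) : ℂ) * T f x).re ≤ (T g x).re := by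
    intro n
    set c : ℂ := ((TopologicalSpace.denseSeq Circle n : Circle) : ℂ) with hc
    have h1 : ∀ᵐ x ∂extVol, ((c • f - g : L2) x).re ≤ 0 := by
      filter_upwards [hfg, Lp.coeFn_sub (c • f) g, Lp.coeFn_smul c f] with x hx hs hm
      rw [hs, Pi.sub_apply, hm, Pi.smul_apply, Complex.sub_re, smul_eq_mul]
      have : (c * f x).re ≤ ‖f x‖ := by
        refine (Complex.re_le_norm _).trans ?_
        rw [norm_mul, hc, Circle.norm_coe, one_mul]
      linarith
    filter_upwards [hT _ h1, Lp.coeFn_sub (c • T f) (T g), Lp.coeFn_smul c (T f)] with x hx hs hm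
    rw [map_sub, map_smul, hs, Pi.sub_apply, hm, Pi.smul_apply, Complex.sub_re,
      smul_eq_mul] at hx
    linarith
  filter_upwards [ae_all_iff.2 h] with x hx using norm_le_of_forall_denseSeq hx

/-- A real square integrable function as an element of the complex `L²` space. -/
def ofRealL2 {u : Plane → ℝ} (hu : MemLp u 2 extVol) : L2 := (MemLp.ofReal (K := ℂ) hu).toLp _

theorem ofRealL2_coe {u : Plane → ℝ} (hu : MemLp u 2 extVol) :
    ofRealL2 hu =ᵐ[extVol] fun x => (u x : ℂ) := (MemLp.ofReal (K := ℂ) hu).coeFn_toLp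

/-- The absolute value of an `L²` function. -/
def absL2 (f : L2) : L2 := ofRealL2 (Lp.memLp f).norm

theorem absL2_coe (f : L2) : absL2 f =ᵐ[extVol] fun x => ((‖f x‖ : ℝ) : ℂ) := ofRealL2_coe _

theorem PreservesBound.norm_le_absL2 {T : L2 →L[ℂ] L2} (hT : PreservesBound T fun _ => 0)
    (f : L2) : ∀ᵐ x ∂extVol, ‖T f x‖ ≤ (T (absL2 f) x).re := by
  refine hT.norm_le ?_
  filter_upwards [absL2_coe f] with x hx
  rw [hx, Complex.ofReal_re]

theorem PreservesBound.re_nonneg {T : L2 →L[ℂ] L2} (hT : PreservesBound T fun _ => 0) {g : L2}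
    (hg : ∀ᵐ x ∂extVol, 0 ≤ (g x).re) : ∀ᵐ x ∂extVol, 0 ≤ (T g x).re := by
  have : ∀ᵐ x ∂extVol, ‖(0 : L2) x‖ ≤ (g x).re := by
    filter_upwards [hg, Lp.coeFn_zero ℂ 2 extVol] with x hx h0
    rw [h0]
    simpa using hx
  filter_upwards [hT.norm_le this] with x hx using (norm_nonneg _).trans hx

/-- A symmetric operator that preserves a bounded weight `h` is a contraction for the weighted
`L¹` norm. -/
theorem lintegral_mul_enorm_le {T : L2 →L[ℂ] L2} (hsymm : ∀ f g, ⟪T f, g⟫_ℂ = ⟪f, T g⟫_ℂ)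
    (h0 : PreservesBound T fun _ => 0) {h : Plane → ℝ} (hT : PreservesBound T h)
    (hm : Measurable h) (hnn : ∀ x, 0 ≤ h x) {C : ℝ} (hC : ∀ x, h x ≤ C) (f : L2) :
    ∫⁻ x, ENNReal.ofReal (h x) * ‖T f x‖ₑ ∂extVol ≤
      ∫⁻ x, ENNReal.ofReal (h x) * ‖f x‖ₑ ∂extVol := by
  have key : ∀ n : ℕ, ∫⁻ x in Metric.closedBall 0 n, ENNReal.ofReal (h x) * ‖T f x‖ₑ ∂extVol ≤
      ∫⁻ x, ENNReal.ofReal (h x) * ‖f x‖ₑ ∂extVol := by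
    intro n
    set A : Set Plane := Metric.closedBall 0 n
    have hA : MeasurableSet A := Metric.isClosed_closedBall.measurableSet
    have hfin : extVol A ≠ ⊤ := (isCompact_closedBall (0 : Plane) n).measure_lt_top.ne
    have mk : MemLp (A.indicator h) 2 extVol := by
      refine MemLp.of_le (memLp_indicator_const 2 hA C (Or.inr hfin))
        (hm.indicator hA).aestronglyMeasurable (Eventually.of_forall fun x => ?_)
      rw [norm_indicator_eq_indicator_norm, norm_indicator_eq_indicator_norm]
      refine Set.indicator_le_indicator ?_
      rw [Real.norm_eq_abs, Real.norm_eq_abs, abs_of_nonneg (hnn x)]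
      exact (hC x).trans (le_abs_self C)
    -- The weight need not be in $L^2$, so it is cut off to $k=h1_A$. Then $0\le Tk\le h$ and
    -- $\int_A h|Tf|\le\langle k,T|f|\rangle=\langle Tk,|f|\rangle\le\int h|f|$.
    set k := ofRealL2 mk with hk
    have hkc := ofRealL2_coe mk
    have Tk_le : ∀ᵐ x ∂extVol, (T k x).re ≤ h x := by
      refine hT k ?_
      filter_upwards [hkc] with x hx
      rw [hk, hx, Complex.ofReal_re]
      exact Set.indicator_le_self' (fun _ _ => hnn _) x
    have Tk_nn : ∀ᵐ x ∂extVol, 0 ≤ (T k x).re := by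
      refine h0.re_nonneg ?_
      filter_upwards [hkc] with x hx
      rw [hk, hx, Complex.ofReal_re]
      exact Set.indicator_nonneg (fun _ _ => hnn _) x
    have e1 : RCLike.re ⟪k, T (absL2 f)⟫_ℂ =
        ∫ x, A.indicator h x * (T (absL2 f) x).re ∂extVol := by
      rw [L2.inner_def, ← integral_re (L2.integrable_inner _ _)]
      refine integral_congr_ae ?_
      filter_upwards [hkc] with x hx
      rw [hk, hx]
      simp [mul_comm]
    have e2 : RCLike.re ⟪T k, absL2 f⟫_ℂ = ∫ x, (T k x).re * ‖f x‖ ∂extVol := by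
      rw [L2.inner_def, ← integral_re (L2.integrable_inner _ _)]
      refine integral_congr_ae ?_
      filter_upwards [absL2_coe f] with x hx
      rw [hx]
      simp [mul_comm]
    have i1 : Integrable (fun x => A.indicator h x * (T (absL2 f) x).re) extVol :=
      mk.integrable_mul (Lp.memLp (T (absL2 f))).re
    have i2 : Integrable (fun x => (T k x).re * ‖f x‖) extVol :=
      (Lp.memLp (T k)).re.integrable_mul (Lp.memLp f).norm
    have dom := h0.norm_le_absL2 f
    calc ∫⁻ x in A, ENNReal.ofReal (h x) * ‖T f x‖ₑ ∂extVol
        = ∫⁻ x, A.indicator (fun x => ENNReal.ofReal (h x) * ‖T f x‖ₑ) x ∂extVol :=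
          (lintegral_indicator hA _).symm
      _ ≤ ∫⁻ x, ENNReal.ofReal (A.indicator h x * (T (absL2 f) x).re) ∂extVol := by
          refine lintegral_mono_ae ?_
          filter_upwards [dom] with x hx
          by_cases hxA : x ∈ A
          · rw [Set.indicator_of_mem hxA, Set.indicator_of_mem hxA, ENNReal.ofReal_mul (hnn x),
              ← ofReal_norm]
            gcongr
          · simp [Set.indicator_of_notMem hxA]
      _ = ENNReal.ofReal (∫ x, A.indicator h x * (T (absL2 f) x).re ∂extVol) := by
          refine (ofReal_integral_eq_lintegral_ofReal i1 ?_).symm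
          filter_upwards [dom] with x hx
          exact mul_nonneg (Set.indicator_nonneg (fun _ _ => hnn _) x) ((norm_nonneg _).trans hx)
      _ = ENNReal.ofReal (∫ x, (T k x).re * ‖f x‖ ∂extVol) := by
          rw [← e1, ← e2, hsymm]
      _ = ∫⁻ x, ENNReal.ofReal ((T k x).re * ‖f x‖) ∂extVol := by
          refine ofReal_integral_eq_lintegral_ofReal i2 ?_
          filter_upwards [Tk_nn] with x hx
          exact mul_nonneg hx (norm_nonneg _)
      _ ≤ ∫⁻ x, ENNReal.ofReal (h x) * ‖f x‖ₑ ∂extVol := by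
          refine lintegral_mono_ae ?_
          filter_upwards [Tk_le, Tk_nn] with x hx hx'
          rw [ENNReal.ofReal_mul hx', ofReal_norm]
          gcongr
  rw [← setLIntegral_univ, ← Metric.iUnion_closedBall_nat (0 : Plane),
    setLIntegral_iUnion_of_directed]
  · exact iSup_le key
  · refine Monotone.directed_le fun m n hmn => ?_
    exact Metric.closedBall_subset_closedBall (by exact_mod_cast hmn)

/-- The convex function $b\mapsto b^p$ lies above its tangent at $a$; this is Bernoulli's inequality
for $b/a$. -/
theorem tangent_le_rpow {p a b : ℝ} (hp : 1 ≤ p) (ha : 0 < a) (hb : 0 ≤ b) :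
    p * a ^ (p - 1) * b ≤ b ^ p + (p - 1) * a ^ p := by
  have h := one_add_mul_self_le_rpow_one_add (s := b / a - 1) (by
    have : 0 ≤ b / a := by positivity
    linarith) hp
  have e : 1 + (b / a - 1) = b / a := by ring
  rw [e, Real.div_rpow hb ha.le, le_div_iff₀ (by positivity)] at h
  have e2 : a ^ p = a ^ (p - 1) * a := by
    rw [← Real.rpow_add_one ha.ne']
    congr 1
    ring
  have e3 : p * a ^ (p - 1) * b = p * (b / a) * a ^ p := by
    rw [e2]
    field_simp
  rw [e3]
  linarith

/-- Jensen's inequality `|T f|ᵖ ≤ T |f|ᵖ` for a sub-Markovian operator. -/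
theorem norm_rpow_le_of_preservesBound {T : L2 →L[ℂ] L2}
    (hT : ∀ c : ℝ, 0 ≤ c → PreservesBound T fun _ => c) {p : ℝ} (hp : 1 ≤ p) {f F : L2}
    (hF : F =ᵐ[extVol] fun x => ((‖f x‖ ^ p : ℝ) : ℂ)) :
    ∀ᵐ x ∂extVol, ‖T f x‖ ^ p ≤ (T F x).re := by
  have h0 := hT 0 le_rfl
  have Fnn : ∀ᵐ x ∂extVol, 0 ≤ (T F x).re := by
    refine h0.re_nonneg ?_
    filter_upwards [hF] with x hx
    rw [hx, Complex.ofReal_re]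
    positivity
  -- $T$ is applied to the tangent inequality $p a^{p-1}|f|-|f|^p\le(p-1)a^p$, a bound by a
  -- nonnegative constant. Rational $a$ keep the null sets countable.
  have h : ∀ a : ℚ, ∀ᵐ x ∂extVol, 0 < (a : ℝ) →
      p * (a : ℝ) ^ (p - 1) * (T (absL2 f) x).re ≤ (T F x).re + (p - 1) * (a : ℝ) ^ p := by
    intro a
    by_cases ha : 0 < (a : ℝ)
    swap
    · exact Eventually.of_forall fun x hx => absurd hx ha
    set c : ℝ := p * (a : ℝ) ^ (p - 1) with hc
    have h1 : ∀ᵐ x ∂extVol, (((c : ℂ) • absL2 f - F : L2) x).re ≤ (p - 1) * (a : ℝ) ^ p := by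
      filter_upwards [hF, absL2_coe f, Lp.coeFn_sub ((c : ℂ) • absL2 f) F,
        Lp.coeFn_smul (c : ℂ) (absL2 f)] with x hx hy hs hm
      rw [hs, Pi.sub_apply, hm, Pi.smul_apply, hx, hy, Complex.sub_re, smul_eq_mul,
        Complex.re_ofReal_mul, Complex.ofReal_re, Complex.ofReal_re]
      linarith [tangent_le_rpow hp ha (norm_nonneg (f x))]
    have h2 := hT _ (mul_nonneg (sub_nonneg.2 hp) (Real.rpow_nonneg ha.le p)) _ h1
    filter_upwards [h2, Lp.coeFn_sub ((c : ℂ) • T (absL2 f)) (T F),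
      Lp.coeFn_smul (c : ℂ) (T (absL2 f))] with x hx hs hm _
    rw [map_sub, map_smul, hs, Pi.sub_apply, hm, Pi.smul_apply, Complex.sub_re, smul_eq_mul,
      Complex.re_ofReal_mul] at hx
    linarith
  filter_upwards [ae_all_iff.2 h, h0.norm_le_absL2 f, Fnn] with x hx hdom hnn
  rcases (norm_nonneg (T f x)).eq_or_lt with hy | hy
  · rw [← hy, Real.zero_rpow (by linarith)]
    exact hnn
  set y := ‖T f x‖
  by_contra hcon
  -- If the claim failed, the tangent inequality would fail strictly at $a=y$, hence at a rational
  -- $a$ near $y$.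
  have hcon' : 0 < p * y ^ (p - 1) * y - (T F x).re - (p - 1) * y ^ p := by
    have : y ^ p = y ^ (p - 1) * y := by
      rw [← Real.rpow_add_one hy.ne']
      congr 1
      ring
    nlinarith
  have hcont : ContinuousAt
      (fun a : ℝ => p * a ^ (p - 1) * y - (T F x).re - (p - 1) * a ^ p) y := by
    have c1 : ContinuousAt (fun a : ℝ => a ^ (p - 1)) y :=
      Real.continuousAt_rpow_const _ _ (Or.inl hy.ne')
    have c2 : ContinuousAt (fun a : ℝ => a ^ p) y :=
      Real.continuousAt_rpow_const _ _ (Or.inl hy.ne')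
    exact (((c1.const_mul p).mul_const y).sub continuousAt_const).sub (c2.const_mul _)
  have hev : {a : ℝ | 0 < a ∧ 0 < p * a ^ (p - 1) * y - (T F x).re - (p - 1) * a ^ p} ∈ 𝓝 y :=
    inter_mem (Ioi_mem_nhds hy) (hcont.eventually (lt_mem_nhds hcon'))
  obtain ⟨a, ha, ha'⟩ := (Rat.denseRange_cast (𝕜 := ℝ)).mem_nhds hev
  have h3 := hx a ha
  have h4 : p * (a : ℝ) ^ (p - 1) * y ≤ p * (a : ℝ) ^ (p - 1) * (T (absL2 f) x).re := by
    gcongr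
  linarith

/-! ### The Nash inequality -/

theorem lintegral_enorm_sq (f : L2) : ∫⁻ x, ‖f x‖ₑ ^ 2 ∂extVol = ENNReal.ofReal (‖f‖ ^ 2) := by
  have h := eLpNorm_eq_lintegral_rpow_enorm_toReal (f := f) (μ := extVol) (p := 2) (by simp)
    (by simp)
  simp only [ENNReal.toReal_ofNat, ENNReal.rpow_ofNat] at h
  rw [Lp.norm_def, ENNReal.ofReal_pow ENNReal.toReal_nonneg,
    ENNReal.ofReal_toReal (Lp.eLpNorm_ne_top f), h, ← ENNReal.rpow_natCast, ← ENNReal.rpow_mul]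
  simp

theorem lintegral_mul_sq_le {f g : Plane → ℝ≥0∞} (hf : AEMeasurable f extVol)
    (hg : AEMeasurable g extVol) :
    (∫⁻ x, f x * g x ∂extVol) ^ 2 ≤ (∫⁻ x, f x ^ 2 ∂extVol) * ∫⁻ x, g x ^ 2 ∂extVol := by
  have h := ENNReal.lintegral_mul_le_Lp_mul_Lq extVol Real.HolderConjugate.two_two hf hg
  simp only [ENNReal.rpow_ofNat] at h
  calc (∫⁻ x, f x * g x ∂extVol) ^ 2
      ≤ ((∫⁻ x, f x ^ 2 ∂extVol) ^ (1 / 2 : ℝ) * (∫⁻ x, g x ^ 2 ∂extVol) ^ (1 / 2 : ℝ)) ^ 2 := by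
        gcongr
        exact h
    _ = _ := by
        rw [mul_pow, ← ENNReal.rpow_natCast, ← ENNReal.rpow_natCast, ← ENNReal.rpow_mul,
          ← ENNReal.rpow_mul]
        simp

theorem norm_clm_le_sum {F : Type*} [NormedAddCommGroup F] [NormedSpace ℝ F]
    (L : Plane →L[ℝ] F) : ‖L‖ ≤ ∑ i, ‖L (EuclideanSpace.single i 1)‖ := by
  refine L.opNorm_le_bound (Finset.sum_nonneg fun _ _ => norm_nonneg _) fun v => ?_
  have hv : v = ∑ i, v i • EuclideanSpace.single i (1 : ℝ) := by
    ext j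
    fin_cases j <;> simp [Fin.sum_univ_two]
  conv_lhs => rw [hv]
  rw [map_sum, Finset.sum_mul]
  refine (norm_sum_le _ _).trans (Finset.sum_le_sum fun i _ => ?_)
  rw [map_smul, norm_smul, mul_comm]
  gcongr
  exact PiLp.norm_apply_le v i

theorem two_mul_ofReal (r : ℝ) : 2 * ENNReal.ofReal r = ENNReal.ofReal (2 * r) := by
  rw [ENNReal.ofReal_mul (by norm_num), ENNReal.ofReal_ofNat]

/-- Ladyzhenskaya's inequality for test functions. -/
theorem exists_ladyzhenskaya_testJets : ∃ C : ℝ, 0 < C ∧ ∀ z ∈ testJets,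
    ∫⁻ x, ‖z.fst x‖ₑ ^ 4 ∂extVol ≤
      ENNReal.ofReal (C * (‖z.fst‖ ^ 2 * ∑ i, ‖z.snd i‖ ^ 2)) := by
  set K : ℝ := ((lintegralPowLePowLIntegralFDerivConst (volume : Measure Plane) 2 : NNReal) : ℝ)
    with hK
  have hK0 : 0 ≤ K := NNReal.coe_nonneg _
  -- The Sobolev inequality $W^{1,1}\subset L^2$ of the plane is applied to $|\varphi|^2$, with
  -- $|\nabla|\varphi|^2|\le2|\varphi||\nabla\varphi|$ and Cauchy–Schwarz. The 8 is $2^2$ from the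
  -- gradient times 2 from squaring a sum of two terms; `K + 1` makes the constant positive.
  refine ⟨8 * (K + 1), by positivity, ?_⟩
  rintro z ⟨φ, hφ, h1, h2⟩
  have hu : ContDiff ℝ 1 fun x => ‖φ x‖ ^ 2 := (hφ.1.of_le (by simp)).norm_sq ℝ
  have hd : ∀ x, ‖fderiv ℝ (fun x => ‖φ x‖ ^ 2) x‖ ≤ 2 * (‖φ x‖ * ∑ i, ‖partialDeriv i φ x‖) := by
    intro x
    have := ((hφ.1.differentiable (by simp) x).hasFDerivAt).norm_sq
    rw [this.fderiv, ← Nat.cast_smul_eq_nsmul ℝ, norm_smul]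
    simp only [Nat.cast_ofNat, Real.norm_ofNat]
    gcongr
    refine (ContinuousLinearMap.opNorm_comp_le _ _).trans ?_
    gcongr
    · exact (innerSL_apply_norm ℝ (φ x)).le
    · exact norm_clm_le_sum _
  have hsub : ∀ x, x ∉ exterior → fderiv ℝ (fun x => ‖φ x‖ ^ 2) x = 0 := by
    intro x hx
    have : (fun x => ‖φ x‖ ^ 2) =ᶠ[𝓝 x] fun _ => 0 := by
      filter_upwards [(isClosed_tsupport φ).isOpen_compl.mem_nhds fun h => hx (hφ.2.2 h)]
        with y hy
      simp [image_eq_zero_of_notMem_tsupport hy]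
    rw [this.fderiv_eq]
    simp
  have gns := lintegral_pow_le_pow_lintegral_fderiv (volume : Measure Plane) hu
    (hφ.2.1.comp_left (g := fun w : ℂ => ‖w‖ ^ 2) (by simp)) (p := 2)
    (by simpa using Real.HolderConjugate.two_two)
  simp only [ENNReal.rpow_ofNat] at gns
  have m1 : AEMeasurable (fun x => ‖z.fst x‖ₑ) extVol := (Lp.aestronglyMeasurable _).enorm
  have m2 : ∀ i, AEMeasurable (fun x => ‖z.snd i x‖ₑ) extVol := fun i =>
    (Lp.aestronglyMeasurable _).enorm
  have I : ∫⁻ x, ‖fderiv ℝ (fun x => ‖φ x‖ ^ 2) x‖ₑ ≤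
      2 * ∫⁻ x, ‖z.fst x‖ₑ * ∑ i, ‖z.snd i x‖ₑ ∂extVol := by
    have m3 : AEMeasurable (fun x => ‖z.fst x‖ₑ * ∑ i, ‖z.snd i x‖ₑ) extVol :=
      m1.mul (Finset.aemeasurable_fun_sum _ fun i _ => m2 i)
    rw [← lintegral_const_mul'' _ m3]
    have hind : (fun x => ‖fderiv ℝ (fun x => ‖φ x‖ ^ 2) x‖ₑ) =
        exterior.indicator fun x => ‖fderiv ℝ (fun x => ‖φ x‖ ^ 2) x‖ₑ := by
      funext x
      by_cases hx : x ∈ exterior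
      · rw [Set.indicator_of_mem hx]
      · rw [Set.indicator_of_notMem hx, hsub x hx, ← ofReal_norm, norm_zero, ENNReal.ofReal_zero]
    rw [hind, lintegral_indicator measurableSet_exterior]
    refine lintegral_mono_ae ?_
    filter_upwards [h1, ae_all_iff.2 h2] with x hx hx'
    rw [hx, ← ofReal_norm, ← ofReal_norm]
    simp_rw [hx', ← ofReal_norm]
    rw [← ENNReal.ofReal_sum_of_nonneg (fun _ _ => norm_nonneg _),
      ← ENNReal.ofReal_mul (norm_nonneg _), two_mul_ofReal]
    exact ENNReal.ofReal_le_ofReal (hd x)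
  calc ∫⁻ x, ‖z.fst x‖ₑ ^ 4 ∂extVol
      = ∫⁻ x, ‖‖φ x‖ ^ 2‖ₑ ^ 2 ∂extVol := by
        refine lintegral_congr_ae ?_
        filter_upwards [h1] with x hx
        rw [hx, enorm_pow, enorm_norm, ← pow_mul]
    _ ≤ ∫⁻ x, ‖‖φ x‖ ^ 2‖ₑ ^ 2 := setLIntegral_le_lintegral _ _
    _ ≤ ENNReal.ofReal K * (∫⁻ x, ‖fderiv ℝ (fun x => ‖φ x‖ ^ 2) x‖ₑ) ^ 2 := by
        rw [hK, ENNReal.ofReal_coe_nnreal]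
        exact gns
    _ ≤ ENNReal.ofReal K * (2 * ∫⁻ x, ‖z.fst x‖ₑ * ∑ i, ‖z.snd i x‖ₑ ∂extVol) ^ 2 := by
        gcongr
    _ = 4 * ENNReal.ofReal K * (∫⁻ x, ‖z.fst x‖ₑ * ∑ i, ‖z.snd i x‖ₑ ∂extVol) ^ 2 := by
        ring
    _ ≤ 4 * ENNReal.ofReal K * ((∫⁻ x, ‖z.fst x‖ₑ ^ 2 ∂extVol) *
          ∫⁻ x, (∑ i, ‖z.snd i x‖ₑ) ^ 2 ∂extVol) := by
        gcongr
        exact lintegral_mul_sq_le m1 (Finset.aemeasurable_fun_sum _ fun i _ => m2 i)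
    _ ≤ 4 * ENNReal.ofReal K * ((∫⁻ x, ‖z.fst x‖ₑ ^ 2 ∂extVol) *
          ∫⁻ x, 2 * ∑ i, ‖z.snd i x‖ₑ ^ 2 ∂extVol) := by
        gcongr with x
        simp_rw [← ofReal_norm, ← ENNReal.ofReal_pow (norm_nonneg _)]
        rw [← ENNReal.ofReal_sum_of_nonneg fun _ _ => norm_nonneg _,
          ← ENNReal.ofReal_sum_of_nonneg fun _ _ => sq_nonneg _,
          ← ENNReal.ofReal_pow (Finset.sum_nonneg fun _ _ => norm_nonneg _),
          two_mul_ofReal]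
        refine ENNReal.ofReal_le_ofReal ?_
        simpa using sq_sum_le_card_mul_sum_sq (s := Finset.univ) (f := fun i => ‖z.snd i x‖)
    _ = ENNReal.ofReal (8 * K * (‖z.fst‖ ^ 2 * ∑ i, ‖z.snd i‖ ^ 2)) := by
        rw [lintegral_const_mul'' _ (Finset.aemeasurable_fun_sum _ fun i _ => (m2 i).pow_const 2),
          lintegral_finsetSum' _ fun i _ => (m2 i).pow_const 2]
        simp_rw [lintegral_enorm_sq]
        rw [← ENNReal.ofReal_sum_of_nonneg fun _ _ => sq_nonneg _,
          ENNReal.ofReal_mul (by positivity), ENNReal.ofReal_mul (by positivity),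
          ENNReal.ofReal_mul (by positivity)]
        simp only [ENNReal.ofReal_ofNat]
        ring
    _ ≤ _ := by
        gcongr
        linarith

/-- Fatou's lemma bounds the left side, and the right side is continuous in the $H^1$ norm. -/
theorem exists_ladyzhenskaya : ∃ C : ℝ, 0 < C ∧ ∀ z ∈ H10,
    ∫⁻ x, ‖z.fst x‖ₑ ^ 4 ∂extVol ≤
      ENNReal.ofReal (C * (‖z.fst‖ ^ 2 * ∑ i, ‖z.snd i‖ ^ 2)) := by
  obtain ⟨C, hC, h⟩ := exists_ladyzhenskaya_testJets
  refine ⟨C, hC, fun z hz => ?_⟩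
  obtain ⟨Z, hZ, hlim, hae⟩ := exists_testJets_tendsto_ae hz
  have hlim' : Tendsto (fun n => ENNReal.ofReal (C * (‖(Z n).fst‖ ^ 2 * ∑ i, ‖(Z n).snd i‖ ^ 2)))
      atTop (𝓝 (ENNReal.ofReal (C * (‖z.fst‖ ^ 2 * ∑ i, ‖z.snd i‖ ^ 2)))) := by
    refine ENNReal.tendsto_ofReal (Tendsto.const_mul C (Tendsto.mul ?_ ?_))
    · exact (tendsto_fst hlim).norm.pow 2
    · exact tendsto_finsetSum _ fun i _ => (tendsto_snd hlim i).norm.pow 2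
  calc ∫⁻ x, ‖z.fst x‖ₑ ^ 4 ∂extVol
      = ∫⁻ x, liminf (fun n => ‖(Z n).fst x‖ₑ ^ 4) atTop ∂extVol := by
        refine lintegral_congr_ae ?_
        filter_upwards [hae] with x hx
        exact ((ENNReal.continuous_pow 4).tendsto _ |>.comp hx.enorm).liminf_eq.symm
    _ ≤ liminf (fun n => ∫⁻ x, ‖(Z n).fst x‖ₑ ^ 4 ∂extVol) atTop :=
        lintegral_liminf_le' fun n => (Lp.aestronglyMeasurable _).enorm.pow_const 4
    _ ≤ liminf (fun n => ENNReal.ofReal (C * (‖(Z n).fst‖ ^ 2 * ∑ i, ‖(Z n).snd i‖ ^ 2)))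
          atTop := liminf_le_liminf (Eventually.of_forall fun n => h _ (hZ n))
    _ = _ := hlim'.liminf_eq

/-- The Nash inequality in `H¹₀`. -/
theorem exists_nash : ∃ C : ℝ, 0 < C ∧ ∀ z ∈ H10, ∀ M E : ℝ, 0 ≤ M → 0 < E →
    ∫⁻ x, ‖z.fst x‖ₑ ∂extVol ≤ ENNReal.ofReal M → ∑ i, ‖z.snd i‖ ^ 2 ≤ E →
    (‖z.fst‖ ^ 2) ^ 2 ≤ C * M ^ 2 * E := by
  obtain ⟨C, hC, h⟩ := exists_ladyzhenskaya
  refine ⟨8 * C, by positivity, fun z hz M E hM hE hL hD => ?_⟩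
  -- Splitting by the size of $|u|$ gives $|u|^2\le K|u|+K^{-2}|u|^4$. For $K^2=2CE$ the quartic
  -- term integrates to at most $\frac12\|u\|^2$ and is absorbed.
  set K := √(2 * C * E) with hK
  have hK0 : 0 < K := Real.sqrt_pos.2 (by positivity)
  have hK2 : K ^ 2 = 2 * C * E := Real.sq_sqrt (by positivity)
  have pt : ∀ x, ‖z.fst x‖ₑ ^ 2 ≤ ENNReal.ofReal K * ‖z.fst x‖ₑ +
      ENNReal.ofReal (1 / K ^ 2) * ‖z.fst x‖ₑ ^ 4 := by
    intro x
    rw [← ofReal_norm, ← ENNReal.ofReal_pow (norm_nonneg _), ← ENNReal.ofReal_pow (norm_nonneg _),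
      ← ENNReal.ofReal_mul hK0.le, ← ENNReal.ofReal_mul (by positivity),
      ← ENNReal.ofReal_add (by positivity) (by positivity)]
    refine ENNReal.ofReal_le_ofReal ?_
    set r := ‖z.fst x‖
    have hr : 0 ≤ r := norm_nonneg _
    rcases le_total r K with hrK | hrK
    · have : 0 ≤ 1 / K ^ 2 * r ^ 4 := by positivity
      nlinarith
    · have h1 : r ^ 2 ≤ 1 / K ^ 2 * r ^ 4 := by
        rw [one_div, ← div_eq_inv_mul, le_div_iff₀ (by positivity)]
        have : K ^ 2 ≤ r ^ 2 := by gcongr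
        nlinarith [sq_nonneg r]
      have : 0 ≤ K * r := by positivity
      linarith
  have m1 : AEMeasurable (fun x => ‖z.fst x‖ₑ) extVol := (Lp.aestronglyMeasurable _).enorm
  have h2 : ENNReal.ofReal (‖z.fst‖ ^ 2) ≤
      ENNReal.ofReal (K * M + 1 / K ^ 2 * (C * (‖z.fst‖ ^ 2 * E))) := by
    rw [← lintegral_enorm_sq]
    refine (lintegral_mono pt).trans ?_
    rw [lintegral_add_left' (m1.const_mul _), lintegral_const_mul'' _ m1,
      lintegral_const_mul'' _ (m1.pow_const 4), ENNReal.ofReal_add (by positivity) (by positivity),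
      ENNReal.ofReal_mul hK0.le, ENNReal.ofReal_mul (p := 1 / K ^ 2) (by positivity)]
    gcongr
    refine (h z hz).trans (ENNReal.ofReal_le_ofReal ?_)
    gcongr
  rw [ENNReal.ofReal_le_ofReal_iff (by positivity), hK2] at h2
  have h3 : 1 / (2 * C * E) * (C * (‖z.fst‖ ^ 2 * E)) = ‖z.fst‖ ^ 2 / 2 := by field_simp
  rw [h3] at h2
  have h4 : ‖z.fst‖ ^ 2 ≤ 2 * (K * M) := by linarith
  calc (‖z.fst‖ ^ 2) ^ 2 ≤ (2 * (K * M)) ^ 2 := by gcongr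
    _ = 4 * K ^ 2 * M ^ 2 := by ring
    _ = _ := by rw [hK2]; ring

/-! ### Ultracontractivity -/

theorem preservesBound_heatL2_const {t : ℝ} (ht : 0 < t) {c : ℝ} (hc : 0 ≤ c) :
    PreservesBound (heatL2 t) fun _ => c := preservesBound_heatL2 ht (isBarrier_const hc)

theorem lintegral_enorm_heatL2_le {t : ℝ} (ht : 0 < t) (f : L2) :
    ∫⁻ x, ‖heatL2 t f x‖ₑ ∂extVol ≤ ∫⁻ x, ‖f x‖ₑ ∂extVol := by
  have := lintegral_mul_enorm_le (inner_heatL2_left t) (preservesBound_heatL2_const ht le_rfl)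
    (preservesBound_heatL2_const ht zero_le_one) measurable_const (fun _ => zero_le_one)
    (fun _ => le_rfl) f
  simpa using this

/-- The `L¹ → L²` bound. -/
theorem exists_norm_sq_heatL2_le : ∃ C : ℝ, 0 < C ∧ ∀ t : ℝ, 0 < t → ∀ (f : L2) (M : ℝ), 0 ≤ M →
    ∫⁻ x, ‖f x‖ₑ ∂extVol ≤ ENNReal.ofReal M → ‖heatL2 t f‖ ^ 2 ≤ C / t * M ^ 2 := by
  obtain ⟨C, hC, nash⟩ := exists_nash
  refine ⟨4 * C, by positivity, fun t ht f M hM hf => ?_⟩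
  -- In place of Nash's differential inequality: Nash and the smoothing estimate on $[\tau/2,\tau]$
  -- give $a(\tau)^2\le K a(\tau/2)$. The supremum $A$ of $a$ over $(0,t]$ is finite, so $A^2\le KA$
  -- and $A\le K$.
  set a : ℝ → ℝ := fun τ => τ * ‖heatL2 τ f‖ ^ 2 with ha
  set K := 4 * C * M ^ 2 with hK
  have hK0 : 0 ≤ K := by positivity
  have step : ∀ τ, 0 < τ → a τ ^ 2 ≤ K * a (τ / 2) := by
    intro τ hτ
    set g := heatL2 (τ / 2) f with hg
    have e : heatL2 τ f = heatL2 (τ / 2) g := heatL2_half hτ f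
    obtain ⟨z, hz, hz1, hz2⟩ := exists_mem_H10_heatL2 (half_pos hτ) g
    rw [← e] at hz1
    rcases eq_or_ne g 0 with h0 | h0
    · have : heatL2 τ f = 0 := by rw [e, h0, map_zero]
      simp only [ha, this, norm_zero]
      rw [← hg, h0]
      simp
    · have hgpos : 0 < ‖g‖ := norm_pos_iff.2 h0
      have h1 := nash z hz M (‖g‖ ^ 2 / (τ / 2)) hM (by positivity)
        (by rw [hz1]; exact (lintegral_enorm_heatL2_le hτ f).trans hf) hz2
      rw [hz1] at h1
      simp only [ha]
      calc (τ * ‖heatL2 τ f‖ ^ 2) ^ 2 = τ ^ 2 * (‖heatL2 τ f‖ ^ 2) ^ 2 := by ring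
        _ ≤ τ ^ 2 * (C * M ^ 2 * (‖g‖ ^ 2 / (τ / 2))) := by gcongr
        _ = K * (τ / 2 * ‖g‖ ^ 2) := by
          rw [hK]
          field_simp
          ring
  set A := sSup (a '' Set.Ioc 0 t) with hA
  have bdd : BddAbove (a '' Set.Ioc 0 t) := by
    refine ⟨t * ‖f‖ ^ 2, ?_⟩
    rintro _ ⟨τ, hτ, rfl⟩
    have := norm_heatL2_le hτ.1 f
    simp only [ha]
    gcongr
    exact hτ.2
  have le_A : ∀ τ ∈ Set.Ioc 0 t, a τ ≤ A := fun τ hτ => le_csSup bdd ⟨τ, hτ, rfl⟩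
  have hA0 : 0 ≤ A := le_trans (by simp only [ha]; positivity) (le_A t ⟨ht, le_rfl⟩)
  have A_le : A ≤ √(K * A) := by
    refine csSup_le ⟨a t, t, ⟨ht, le_rfl⟩, rfl⟩ ?_
    rintro _ ⟨τ, hτ, rfl⟩
    refine Real.le_sqrt_of_sq_le ((step τ hτ.1).trans ?_)
    gcongr
    exact le_A _ ⟨half_pos hτ.1, by linarith [hτ.1, hτ.2]⟩
  have A_sq : A ^ 2 ≤ K * A := by
    calc A ^ 2 ≤ √(K * A) ^ 2 := by gcongr
      _ = K * A := Real.sq_sqrt (by positivity)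
  have A_le_K : A ≤ K := by
    rcases hA0.eq_or_lt with h | h
    · rw [← h]; exact hK0
    · nlinarith
  have h2 := (le_A t ⟨ht, le_rfl⟩).trans A_le_K
  simp only [ha, hK] at h2
  rw [div_mul_eq_mul_div, le_div_iff₀ ht]
  linarith

/-- The `L¹ → L^∞` bound. -/
theorem exists_enorm_heatL2_le : ∃ C : ℝ, 0 < C ∧ ∀ t : ℝ, 0 < t → ∀ f : L2,
    ∀ᵐ x ∂extVol, ‖heatL2 t f x‖ₑ ≤ ENNReal.ofReal (C / t) * ∫⁻ x, ‖f x‖ₑ ∂extVol := by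
  obtain ⟨C, hC, h12⟩ := exists_norm_sq_heatL2_le
  refine ⟨2 * C, by positivity, fun t ht f => ?_⟩
  by_cases hfin : ∫⁻ x, ‖f x‖ₑ ∂extVol = ⊤
  · rw [hfin, ENNReal.mul_top (by simpa using by positivity)]
    exact Eventually.of_forall fun _ => le_top
  set M := (∫⁻ x, ‖f x‖ₑ ∂extVol).toReal with hM
  have hM0 : 0 ≤ M := ENNReal.toReal_nonneg
  have hMf : ∫⁻ x, ‖f x‖ₑ ∂extVol = ENNReal.ofReal M := (ENNReal.ofReal_toReal hfin).symm
  have hMabs : ∫⁻ x, ‖absL2 f x‖ₑ ∂extVol ≤ ENNReal.ofReal M := by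
    rw [← hMf]
    refine lintegral_mono_ae ?_
    filter_upwards [absL2_coe f] with x hx
    rw [hx, ← ofReal_norm, Complex.norm_real, norm_norm, ofReal_norm]
  have dom := (preservesBound_heatL2_const ht le_rfl).norm_le_absL2 f
  have key : (fun x => ‖heatL2 t f x‖ₑ) ≤ᵐ[extVol]
      fun _ => ENNReal.ofReal (2 * C / t * M) := by
    -- Duality: for the indicator $k$ of a set of finite measure, $\langle k,S(t)|f|\rangle=\langle
    -- S(t/2)k,S(t/2)|f|\rangle$, and the $L^1\to L^2$ bound applies to both factors.
    refine ae_le_of_forall_setLIntegral_le_of_sigmaFinite₀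
      (Lp.aestronglyMeasurable _).enorm fun A hA hAfin => ?_
    have mA : MemLp (A.indicator fun _ => (1 : ℝ)) 2 extVol :=
      memLp_indicator_const 2 hA 1 (Or.inr hAfin.ne)
    set k := ofRealL2 mA with hk
    have hkc := ofRealL2_coe mA
    have i1 : Integrable (fun x => A.indicator (fun _ => (1 : ℝ)) x *
        (heatL2 t (absL2 f) x).re) extVol :=
      mA.integrable_mul (Lp.memLp (heatL2 t (absL2 f))).re
    have e1 : RCLike.re ⟪k, heatL2 t (absL2 f)⟫_ℂ =
        ∫ x, A.indicator (fun _ => (1 : ℝ)) x * (heatL2 t (absL2 f) x).re ∂extVol := by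
      rw [L2.inner_def, ← integral_re (L2.integrable_inner _ _)]
      refine integral_congr_ae ?_
      filter_upwards [hkc] with x hx
      rw [hk, hx]
      simp [mul_comm]
    have hkM : ∫⁻ x, ‖k x‖ₑ ∂extVol ≤ ENNReal.ofReal (extVol A).toReal := by
      rw [ENNReal.ofReal_toReal hAfin.ne, ← lintegral_indicator_one hA]
      refine lintegral_mono_ae ?_
      filter_upwards [hkc] with x hx
      rw [hk, hx]
      by_cases hxA : x ∈ A <;> simp [hxA]
    have b1 := h12 (t / 2) (half_pos ht) k _ ENNReal.toReal_nonneg hkM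
    have b2 := h12 (t / 2) (half_pos ht) (absL2 f) M hM0 hMabs
    have b3 : RCLike.re ⟪k, heatL2 t (absL2 f)⟫_ℂ ≤ 2 * C / t * M * (extVol A).toReal := by
      rw [heatL2_half ht, ← inner_heatL2_left]
      refine (re_inner_le_norm _ _).trans ?_
      refine abs_le_of_sq_le_sq' ?_ (by positivity) |>.2
      rw [mul_pow]
      calc ‖heatL2 (t / 2) k‖ ^ 2 * ‖heatL2 (t / 2) (absL2 f)‖ ^ 2
          ≤ (C / (t / 2) * (extVol A).toReal ^ 2) * (C / (t / 2) * M ^ 2) := by gcongr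
        _ = _ := by
          field_simp
    calc ∫⁻ x in A, ‖heatL2 t f x‖ₑ ∂extVol
        = ∫⁻ x, A.indicator (fun x => ‖heatL2 t f x‖ₑ) x ∂extVol :=
          (lintegral_indicator hA _).symm
      _ ≤ ∫⁻ x, ENNReal.ofReal (A.indicator (fun _ => (1 : ℝ)) x *
            (heatL2 t (absL2 f) x).re) ∂extVol := by
          refine lintegral_mono_ae ?_
          filter_upwards [dom] with x hx
          by_cases hxA : x ∈ A
          · rw [Set.indicator_of_mem hxA, Set.indicator_of_mem hxA, one_mul, ← ofReal_norm]
            gcongr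
          · simp [Set.indicator_of_notMem hxA]
      _ = ENNReal.ofReal (∫ x, A.indicator (fun _ => (1 : ℝ)) x *
            (heatL2 t (absL2 f) x).re ∂extVol) := by
          refine (ofReal_integral_eq_lintegral_ofReal i1 ?_).symm
          filter_upwards [dom] with x hx
          exact mul_nonneg (Set.indicator_nonneg (fun _ _ => zero_le_one) x)
            ((norm_nonneg _).trans hx)
      _ ≤ ENNReal.ofReal (2 * C / t * M * (extVol A).toReal) := by
          rw [← e1]
          exact ENNReal.ofReal_le_ofReal b3
      _ = ∫⁻ _ in A, ENNReal.ofReal (2 * C / t * M) ∂extVol := by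
          rw [setLIntegral_const, ENNReal.ofReal_mul (by positivity),
            ENNReal.ofReal_toReal hAfin.ne]
  filter_upwards [key] with x hx
  rw [hMf, ← ENNReal.ofReal_mul (by positivity)]
  exact hx

/-! ### Logarithmic decay in `L¹` -/

theorem lintegral_logMeasure {g : Plane → ℝ≥0∞} (hg : AEMeasurable g extVol) :
    ∫⁻ x, g x ∂logMeasure = ∫⁻ x, ENNReal.ofReal (1 + Real.log ‖x‖) * g x ∂extVol :=
  lintegral_withDensity_eq_lintegral_mul₀ (by fun_prop) hg

theorem one_le_one_add_log {x : Plane} (hx : x ∈ exterior) : 1 ≤ 1 + Real.log ‖x‖ := by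
  have := Real.log_pos hx
  linarith

theorem extVol_le_logMeasure : extVol ≤ logMeasure := by
  rw [Measure.le_iff]
  intro s hs
  rw [logMeasure, withDensity_apply _ hs, ← setLIntegral_one]
  refine lintegral_mono_ae ?_
  filter_upwards [ae_restrict_of_ae ae_mem_exterior] with x hx
  simpa using one_le_one_add_log hx

theorem powBarrier_le_const {a : ℝ} (ha : 0 < a) (x : Plane) : powBarrier a x ≤ 1 / (2 * a) := by
  unfold powBarrier
  split_ifs
  · gcongr
    have : 0 ≤ (‖x‖ ^ 2) ^ (-a) := by positivity
    linarith
  · positivity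

/-- Inside the ball of radius $R$ the sup bound is multiplied by the area $\pi R^2$. Outside, the
barrier with $a=1/(2\log R)$ is at least $\frac12\log R$, and its weighted $L^1$ norm does not grow.
-/
theorem lintegral_enorm_heatL2_le_add {C : ℝ} (hC : 0 < C) {t : ℝ} (ht : 0 < t) {f : L2}
    (hbd : ∀ᵐ x ∂extVol, ‖heatL2 t f x‖ₑ ≤ ENNReal.ofReal (C / t) * ∫⁻ x, ‖f x‖ₑ ∂extVol)
    {R : ℝ} (hR : 1 < R) :
    ∫⁻ x, ‖heatL2 t f x‖ₑ ∂extVol ≤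
      ENNReal.ofReal (C / t * (R ^ 2 * Real.pi) + 2 / Real.log R) *
        ∫⁻ x, ‖f x‖ₑ ∂logMeasure := by
  have hl : 0 < Real.log R := Real.log_pos hR
  set a := 1 / (2 * Real.log R) with ha
  have ha0 : 0 < a := by positivity
  set A : Set Plane := Metric.closedBall 0 R
  have hA : MeasurableSet A := Metric.isClosed_closedBall.measurableSet
  have hvol : extVol A ≤ ENNReal.ofReal (R ^ 2 * Real.pi) := by
    refine (Measure.restrict_le_self A).trans ?_
    rw [EuclideanSpace.volume_closedBall_fin_two, ENNReal.ofReal_mul (by positivity),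
      ENNReal.ofReal_pow (by positivity), ← NNReal.coe_real_pi, ENNReal.ofReal_coe_nnreal]
  have hfm : AEMeasurable (fun x => ‖f x‖ₑ) extVol := (Lp.aestronglyMeasurable f).enorm
  have hM : ∫⁻ x, ‖f x‖ₑ ∂extVol ≤ ∫⁻ x, ‖f x‖ₑ ∂logMeasure :=
    lintegral_mono' extVol_le_logMeasure le_rfl
  rw [← lintegral_add_compl _ hA, ENNReal.ofReal_add (by positivity) (by positivity), add_mul]
  refine add_le_add ?_ ?_
  · calc ∫⁻ x in A, ‖heatL2 t f x‖ₑ ∂extVol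
        ≤ ∫⁻ _ in A, ENNReal.ofReal (C / t) * ∫⁻ x, ‖f x‖ₑ ∂extVol ∂extVol :=
          lintegral_mono_ae (ae_restrict_of_ae hbd)
      _ = ENNReal.ofReal (C / t) * (∫⁻ x, ‖f x‖ₑ ∂extVol) * extVol A := setLIntegral_const _ _
      _ ≤ ENNReal.ofReal (C / t) * (∫⁻ x, ‖f x‖ₑ ∂logMeasure) *
            ENNReal.ofReal (R ^ 2 * Real.pi) := by gcongr
      _ = _ := by
          rw [ENNReal.ofReal_mul (p := C / t) (by positivity)]
          ring
  · have hw := lintegral_mul_enorm_le (inner_heatL2_left t)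
      (preservesBound_heatL2_const ht le_rfl)
      (preservesBound_heatL2 ht (isBarrier_powBarrier ha0)) (measurable_powBarrier a)
      (powBarrier_nonneg ha0) (powBarrier_le_const ha0) f
    have hm : AEMeasurable (fun x => ENNReal.ofReal (powBarrier a x) * ‖heatL2 t f x‖ₑ) extVol :=
      (measurable_powBarrier a).ennreal_ofReal.aemeasurable.mul
        (Lp.aestronglyMeasurable _).enorm
    calc ∫⁻ x in Aᶜ, ‖heatL2 t f x‖ₑ ∂extVol
        ≤ ∫⁻ x in Aᶜ, ENNReal.ofReal (2 / Real.log R) *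
            (ENNReal.ofReal (powBarrier a x) * ‖heatL2 t f x‖ₑ) ∂extVol := by
          refine setLIntegral_mono_ae' hA.compl (Eventually.of_forall fun x hx => ?_)
          have hx' : R ≤ ‖x‖ := by
            by_contra hc
            exact hx (by simpa [A] using (not_le.1 hc).le)
          have h1 := half_log_le_powBarrier hR hx'
          rw [← mul_assoc, ← ENNReal.ofReal_mul (by positivity)]
          refine le_mul_of_one_le_left zero_le ?_
          rw [ENNReal.one_le_ofReal, div_mul_eq_mul_div, le_div_iff₀ hl]
          linarith
      _ ≤ ∫⁻ x, ENNReal.ofReal (2 / Real.log R) *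
            (ENNReal.ofReal (powBarrier a x) * ‖heatL2 t f x‖ₑ) ∂extVol :=
          setLIntegral_le_lintegral _ _
      _ = ENNReal.ofReal (2 / Real.log R) *
            ∫⁻ x, ENNReal.ofReal (powBarrier a x) * ‖heatL2 t f x‖ₑ ∂extVol :=
          lintegral_const_mul'' _ hm
      _ ≤ ENNReal.ofReal (2 / Real.log R) *
            ∫⁻ x, ENNReal.ofReal (powBarrier a x) * ‖f x‖ₑ ∂extVol := by gcongr
      _ ≤ ENNReal.ofReal (2 / Real.log R) *
            ∫⁻ x, ENNReal.ofReal (1 + Real.log ‖x‖) * ‖f x‖ₑ ∂extVol := by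
          refine mul_le_mul' le_rfl (lintegral_mono_ae ?_)
          filter_upwards [ae_mem_exterior] with x hx
          gcongr
          linarith [powBarrier_le_log ha0 hx]
      _ = _ := by rw [lintegral_logMeasure hfm]

theorem exists_lintegral_enorm_heatL2_le_log : ∃ C : ℝ, 0 < C ∧ ∀ t : ℝ, 0 < t → ∀ f : L2,
    ∫⁻ x, ‖heatL2 t f x‖ₑ ∂extVol ≤
      ENNReal.ofReal (C / (1 + Real.log (1 + t))) * ∫⁻ x, ‖f x‖ₑ ∂logMeasure := by
  obtain ⟨C, hC, hbd⟩ := exists_enorm_heatL2_le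
  have hpi := Real.pi_pos
  refine ⟨6 * (C * Real.pi) + 24, by positivity, fun t ht f => ?_⟩
  have hL0 : 0 < Real.log (1 + t) := Real.log_pos (by linarith)
  have hL : 0 < 1 + Real.log (1 + t) := by linarith
  rcases lt_or_ge t 4 with h4 | h4
  -- For $t<4$ the logarithmic factor is bounded and contractivity is enough.
  · refine (lintegral_enorm_heatL2_le ht f).trans ?_
    refine (lintegral_mono' extVol_le_logMeasure le_rfl).trans
      (le_mul_of_one_le_left zero_le ?_)
    rw [ENNReal.one_le_ofReal, le_div_iff₀ hL]
    have h1 : Real.log (1 + t) ≤ t := by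
      linarith [Real.log_le_sub_one_of_pos (show 0 < 1 + t by linarith)]
    have : 0 < C * Real.pi := by positivity
    linarith
  -- The terms become $C\pi/\sqrt t$ and $8/\log t$. As $t\ge4$, $1+\log(1+t)\le3\log t\le6\sqrt t$,
  -- which accounts for the constants 6 and 24.
  · set R := t ^ (1 / 4 : ℝ) with hR
    have hR1 : 1 < R := Real.one_lt_rpow (by linarith) (by norm_num)
    have hR2 : R ^ 2 = √t := by
      rw [hR, ← Real.rpow_natCast, ← Real.rpow_mul ht.le, Real.sqrt_eq_rpow]
      norm_num
    have hlogR : Real.log R = Real.log t / 4 := by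
      rw [hR, Real.log_rpow ht]
      ring
    refine (lintegral_enorm_heatL2_le_add hC ht (hbd t ht f) hR1).trans ?_
    gcongr
    rw [hR2, hlogR]
    have hs : 0 < √t := Real.sqrt_pos.2 ht
    have hst : √t * √t = t := Real.mul_self_sqrt ht.le
    have l1 : 1 ≤ Real.log t := by
      rw [Real.le_log_iff_exp_le ht]
      linarith [Real.exp_one_lt_d9]
    have l2 : Real.log (1 + t) ≤ 2 * Real.log t := by
      calc Real.log (1 + t) ≤ Real.log (t ^ 2) := Real.log_le_log (by linarith) (by nlinarith)
        _ = 2 * Real.log t := by rw [Real.log_pow]; norm_num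
    have l3 : Real.log t ≤ 2 * √t := by
      have : Real.log t = 2 * Real.log √t := by rw [Real.log_sqrt ht.le]; ring
      rw [this]
      linarith [Real.log_le_sub_one_of_pos hs]
    have b1 : C / t * (√t * Real.pi) ≤ 6 * (C * Real.pi) / (1 + Real.log (1 + t)) := by
      have : C / t * (√t * Real.pi) = C * Real.pi / √t := by
        rw [eq_div_iff hs.ne']
        calc C / t * (√t * Real.pi) * √t = C / t * (√t * √t) * Real.pi := by ring
          _ = C * Real.pi := by rw [hst, div_mul_cancel₀ _ ht.ne']
      rw [this, div_le_div_iff₀ hs hL]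
      have : 0 < C * Real.pi := by positivity
      nlinarith
    have b2 : 2 / (Real.log t / 4) ≤ 24 / (1 + Real.log (1 + t)) := by
      rw [div_le_div_iff₀ (by linarith) hL]
      linarith
    rw [add_div]
    exact add_le_add b1 b2

/-! ### Estimates for bounded functions -/

theorem norm_heatL2_le_of_norm_le {t : ℝ} (ht : 0 < t) {f : L2} {K : ℝ}
    (hK : ∀ᵐ x ∂extVol, ‖f x‖ ≤ K) : ∀ᵐ x ∂extVol, ‖heatL2 t f x‖ ≤ K := by
  by_cases hK0 : 0 ≤ K
  swap
  · filter_upwards [hK] with x hx using absurd ((norm_nonneg _).trans hx) hK0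
  have h : ∀ n, ∀ᵐ x ∂extVol,
      (((TopologicalSpace.denseSeq Circle n : Circle) : ℂ) * heatL2 t f x).re ≤ K := by
    intro n
    set c : ℂ := ((TopologicalSpace.denseSeq Circle n : Circle) : ℂ) with hc
    have h1 : ∀ᵐ x ∂extVol, ((c • f : L2) x).re ≤ K := by
      filter_upwards [hK, Lp.coeFn_smul c f] with x hx hm
      rw [hm, Pi.smul_apply, smul_eq_mul]
      refine (Complex.re_le_norm _).trans ?_
      rwa [norm_mul, hc, Circle.norm_coe, one_mul]
    filter_upwards [preservesBound_heatL2_const ht hK0 _ h1, Lp.coeFn_smul c (heatL2 t f)]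
      with x hx hm
    rwa [map_smul, hm, Pi.smul_apply, smul_eq_mul] at hx
  filter_upwards [ae_all_iff.2 h] with x hx using norm_le_of_forall_denseSeq hx

/-- Boundedness puts $|g|^p\le K^{p-1}|g|$ in $L^2$, where the semigroup acts. With Jensen's
inequality every $L^1$ estimate then becomes one for $p$-th powers. -/
theorem exists_rpow_L2 {g : L2} {K : ℝ} (hK : ∀ᵐ x ∂extVol, ‖g x‖ ≤ K) {p : ℝ} (hp : 1 ≤ p) :
    ∃ F : L2, (∀ᵐ x ∂extVol, ‖F x‖ₑ = ‖g x‖ₑ ^ p) ∧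
      ∀ t, 0 < t → ∀ᵐ x ∂extVol, ‖heatL2 t g x‖ₑ ^ p ≤ ‖heatL2 t F x‖ₑ := by
  have hp0 : 0 ≤ p := by linarith
  have mF : MemLp (fun x => ‖g x‖ ^ p) 2 extVol := by
    refine MemLp.of_le_mul (c := K ^ (p - 1)) (Lp.memLp g) ?_ ?_
    · exact (Real.continuous_rpow_const hp0).comp_aestronglyMeasurable
        (Lp.aestronglyMeasurable g).norm
    · filter_upwards [hK] with x hx
      rw [Real.norm_eq_abs, abs_of_nonneg (by positivity)]
      rcases (norm_nonneg (g x)).eq_or_lt with h0 | h0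
      · rw [← h0, Real.zero_rpow (by linarith), mul_zero]
      · have : ‖g x‖ ^ p = ‖g x‖ ^ (p - 1) * ‖g x‖ := by
          rw [← Real.rpow_add_one h0.ne', sub_add_cancel]
        rw [this]
        gcongr
  refine ⟨ofRealL2 mF, ?_, fun t ht => ?_⟩
  · filter_upwards [ofRealL2_coe mF] with x hx
    rw [hx, ← ofReal_norm, ← ofReal_norm, Complex.norm_real, Real.norm_eq_abs,
      abs_of_nonneg (by positivity), ENNReal.ofReal_rpow_of_nonneg (norm_nonneg _) hp0]
  · filter_upwards [norm_rpow_le_of_preservesBound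
      (fun c hc => preservesBound_heatL2_const ht hc) hp (ofRealL2_coe mF)] with x hx
    rw [← ofReal_norm, ← ofReal_norm, ENNReal.ofReal_rpow_of_nonneg (norm_nonneg _) hp0]
    exact ENNReal.ofReal_le_ofReal (hx.trans (Complex.re_le_norm _))

theorem lintegral_rpow_heatL2_le {g : L2} {K : ℝ} (hK : ∀ᵐ x ∂extVol, ‖g x‖ ≤ K) {p : ℝ}
    (hp : 1 ≤ p) {t : ℝ} (ht : 0 < t) :
    ∫⁻ x, ‖heatL2 t g x‖ₑ ^ p ∂extVol ≤ ∫⁻ x, ‖g x‖ₑ ^ p ∂extVol := by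
  obtain ⟨F, hF1, hF2⟩ := exists_rpow_L2 hK hp
  calc ∫⁻ x, ‖heatL2 t g x‖ₑ ^ p ∂extVol ≤ ∫⁻ x, ‖heatL2 t F x‖ₑ ∂extVol :=
        lintegral_mono_ae (hF2 t ht)
    _ ≤ ∫⁻ x, ‖F x‖ₑ ∂extVol := lintegral_enorm_heatL2_le ht F
    _ = _ := lintegral_congr_ae hF1

theorem logMeasure_absolutelyContinuous : logMeasure ≪ extVol :=
  withDensity_absolutelyContinuous _ _

theorem exists_lintegral_rpow_heatL2_le_log : ∃ C : ℝ, 0 < C ∧ ∀ (g : L2) (K : ℝ),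
    (∀ᵐ x ∂extVol, ‖g x‖ ≤ K) → ∀ p : ℝ, 1 ≤ p → ∀ t : ℝ, 0 < t →
      ∫⁻ x, ‖heatL2 t g x‖ₑ ^ p ∂extVol ≤
        ENNReal.ofReal (C / (1 + Real.log (1 + t))) * ∫⁻ x, ‖g x‖ₑ ^ p ∂logMeasure := by
  obtain ⟨C, hC, h⟩ := exists_lintegral_enorm_heatL2_le_log
  refine ⟨C, hC, fun g K hK p hp t ht => ?_⟩
  obtain ⟨F, hF1, hF2⟩ := exists_rpow_L2 hK hp
  calc ∫⁻ x, ‖heatL2 t g x‖ₑ ^ p ∂extVol ≤ ∫⁻ x, ‖heatL2 t F x‖ₑ ∂extVol :=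
        lintegral_mono_ae (hF2 t ht)
    _ ≤ _ := h t ht F
    _ = _ := by
        congr 1
        exact lintegral_congr_ae (logMeasure_absolutelyContinuous.ae_le hF1)

theorem exists_enorm_rpow_heatL2_le : ∃ C : ℝ, 0 < C ∧ ∀ (g : L2) (K : ℝ),
    (∀ᵐ x ∂extVol, ‖g x‖ ≤ K) → ∀ p : ℝ, 1 ≤ p → ∀ t : ℝ, 0 < t →
      ∀ᵐ x ∂extVol, ‖heatL2 t g x‖ₑ ^ p ≤
        ENNReal.ofReal (C / t) * ∫⁻ x, ‖g x‖ₑ ^ p ∂extVol := by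
  obtain ⟨C, hC, h⟩ := exists_enorm_heatL2_le
  refine ⟨C, hC, fun g K hK p hp t ht => ?_⟩
  obtain ⟨F, hF1, hF2⟩ := exists_rpow_L2 hK hp
  filter_upwards [hF2 t ht, h t ht F] with x hx hxF
  rw [← lintegral_congr_ae hF1]
  exact hx.trans hxF

/-- Interpolation between an `Lᵖ` bound and a pointwise bound. -/
theorem eLpNorm_le_of_rpow_le {μ : Measure Plane} {u : Plane → ℂ} {p q : ℝ≥0∞} (hp : 1 ≤ p)
    (hp' : p ≠ ⊤) (hpq : p ≤ q) (hu : AEStronglyMeasurable u μ) {B N : ℝ≥0∞}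
    (hN : ∫⁻ x, ‖u x‖ₑ ^ p.toReal ∂μ ≤ N)
    (hB : ∀ᵐ x ∂μ, ‖u x‖ₑ ^ p.toReal ≤ B * N) :
    eLpNorm u q μ ≤ B ^ ((1 / p).toReal - (1 / q).toReal) * N ^ (1 / p).toReal := by
  have hp0 : p ≠ 0 := (zero_lt_one.trans_le hp).ne'
  have hpr : 0 < p.toReal := ENNReal.toReal_pos hp0 hp'
  have e1 : (1 / p).toReal = 1 / p.toReal := by rw [ENNReal.toReal_div, ENNReal.toReal_one]
  by_cases hq : q = ⊤
  · subst hq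
    simp only [ENNReal.div_top, ENNReal.toReal_zero, sub_zero]
    rw [eLpNorm_exponent_top]
    refine eLpNormEssSup_le_of_ae_enorm_bound ?_
    filter_upwards [hB] with x hx
    rw [e1, ← ENNReal.mul_rpow_of_nonneg _ _ (by positivity)]
    rw [one_div]
    exact (ENNReal.le_rpow_inv_iff hpr).2 hx
  · have hq0 : q ≠ 0 := (zero_lt_one.trans_le (hp.trans hpq)).ne'
    have hqr : 0 < q.toReal := ENNReal.toReal_pos hq0 hq
    have hle : p.toReal ≤ q.toReal := ENNReal.toReal_mono hq hpq
    have e2 : (1 / q).toReal = 1 / q.toReal := by rw [ENNReal.toReal_div, ENNReal.toReal_one]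
    -- Since $|u|^q=(|u|^p)^r|u|^p$, the pointwise bound is used on the first factor and the
    -- integral bound on the second.
    set r := q.toReal / p.toReal - 1 with hr
    have hr0 : 0 ≤ r := by
      rw [hr, sub_nonneg, le_div_iff₀ hpr]
      linarith
    have hI : ∫⁻ x, ‖u x‖ₑ ^ q.toReal ∂μ ≤ B ^ r * N ^ (q.toReal / p.toReal) := by
      calc ∫⁻ x, ‖u x‖ₑ ^ q.toReal ∂μ
          ≤ ∫⁻ x, (B * N) ^ r * ‖u x‖ₑ ^ p.toReal ∂μ := by
            refine lintegral_mono_ae ?_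
            filter_upwards [hB] with x hx
            have : ‖u x‖ₑ ^ q.toReal = (‖u x‖ₑ ^ p.toReal) ^ r * ‖u x‖ₑ ^ p.toReal := by
              rw [← ENNReal.rpow_mul, ← ENNReal.rpow_add_of_nonneg _ _ (by positivity) hpr.le]
              congr 1
              rw [hr]
              field_simp
              ring
            rw [this]
            gcongr
        _ = (B * N) ^ r * ∫⁻ x, ‖u x‖ₑ ^ p.toReal ∂μ :=
            lintegral_const_mul'' _ (hu.enorm.pow_const _)
        _ ≤ (B * N) ^ r * N := by gcongr
        _ = B ^ r * N ^ (q.toReal / p.toReal) := by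
            rw [ENNReal.mul_rpow_of_nonneg _ _ hr0, mul_assoc]
            congr 1
            conv_lhs => rw [← ENNReal.rpow_one N]
            rw [← ENNReal.rpow_mul, one_mul, ← ENNReal.rpow_add_of_nonneg _ _ hr0 zero_le_one, hr,
              sub_add_cancel]
    rw [eLpNorm_eq_lintegral_rpow_enorm_toReal hq0 hq, e1, e2]
    calc (∫⁻ x, ‖u x‖ₑ ^ q.toReal ∂μ) ^ (1 / q.toReal)
        ≤ (B ^ r * N ^ (q.toReal / p.toReal)) ^ (1 / q.toReal) := by gcongr
      _ = _ := by
          rw [ENNReal.mul_rpow_of_nonneg _ _ (by positivity), ← ENNReal.rpow_mul,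
            ← ENNReal.rpow_mul]
          congr 2
          · rw [hr]
            field_simp
          · field_simp

theorem exists_eLpNorm_heatL2_le (p q : ℝ≥0∞) (hp : 1 ≤ p) (hp' : p ≠ ⊤) (hpq : p ≤ q) :
    ∃ C : ℝ, 0 < C ∧ ∀ (g : L2) (K : ℝ), (∀ᵐ x ∂extVol, ‖g x‖ ≤ K) → ∀ t : ℝ, 0 < t →
      eLpNorm (heatL2 t g) q extVol ≤
        ENNReal.ofReal (C / (t ^ ((1 / p).toReal - (1 / q).toReal) *
          (1 + Real.log (1 + t)) ^ (1 / p).toReal)) * eLpNorm g p logMeasure := by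
  obtain ⟨C₁, hC₁, h₁⟩ := exists_lintegral_rpow_heatL2_le_log
  obtain ⟨C₂, hC₂, h₂⟩ := exists_enorm_rpow_heatL2_le
  have hp0 : p ≠ 0 := (zero_lt_one.trans_le hp).ne'
  have hpr : 1 ≤ p.toReal := by simpa using ENNReal.toReal_mono hp' hp
  set α := (1 / p).toReal - (1 / q).toReal with hα
  set β := (1 / p).toReal with hβ
  have hβ0 : 0 ≤ β := ENNReal.toReal_nonneg
  have hα0 : 0 ≤ α := by
    rw [hα, sub_nonneg]
    refine ENNReal.toReal_mono (by simp [hp0]) ?_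
    gcongr
  -- With $S(t)=S(t/2)S(t/2)$, the inner factor gives the logarithmic decay and the outer one the
  -- smoothing. Both 2's come from halving the time; for the logarithm, $1+t\le(1+t/2)^2$.
  refine ⟨(2 * C₂) ^ α * (2 * C₁) ^ β, by positivity, fun g K hK t ht => ?_⟩
  have ht2 := half_pos ht
  set w := heatL2 (t / 2) g with hw
  have hwK : ∀ᵐ x ∂extVol, ‖w x‖ ≤ K := norm_heatL2_le_of_norm_le ht2 hK
  have key := eLpNorm_le_of_rpow_le hp hp' hpq (Lp.aestronglyMeasurable _)
    (lintegral_rpow_heatL2_le hwK hpr ht2)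
    (h₂ w K hwK p.toReal hpr _ ht2)
  rw [heatL2_half ht]
  refine key.trans ?_
  have hL : 0 < 1 + Real.log (1 + t) := by
    have := Real.log_pos (show 1 < 1 + t by linarith)
    linarith
  have hL2 : 0 < 1 + Real.log (1 + t / 2) := by
    have := Real.log_pos (show 1 < 1 + t / 2 by linarith)
    linarith
  have hLL : 1 + Real.log (1 + t) ≤ 2 * (1 + Real.log (1 + t / 2)) := by
    have : Real.log (1 + t) ≤ 2 * Real.log (1 + t / 2) := by
      calc Real.log (1 + t) ≤ Real.log ((1 + t / 2) ^ 2) :=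
            Real.log_le_log (by linarith) (by nlinarith)
        _ = _ := by rw [Real.log_pow]; norm_num
    linarith
  have hN : (∫⁻ x, ‖w x‖ₑ ^ p.toReal ∂extVol) ^ β ≤
      ENNReal.ofReal (2 * C₁ / (1 + Real.log (1 + t))) ^ β * eLpNorm g p logMeasure := by
    have e1 : β = 1 / p.toReal := by rw [hβ, ENNReal.toReal_div, ENNReal.toReal_one]
    rw [eLpNorm_eq_lintegral_rpow_enorm_toReal hp0 hp', ← e1, ← ENNReal.mul_rpow_of_nonneg _ _ hβ0]
    gcongr
    refine (h₁ g K hK p.toReal hpr _ ht2).trans ?_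
    gcongr ENNReal.ofReal ?_ * _
    rw [div_le_div_iff₀ hL2 hL]
    nlinarith
  calc ENNReal.ofReal (C₂ / (t / 2)) ^ α * (∫⁻ x, ‖w x‖ₑ ^ p.toReal ∂extVol) ^ β
      ≤ ENNReal.ofReal (C₂ / (t / 2)) ^ α *
          (ENNReal.ofReal (2 * C₁ / (1 + Real.log (1 + t))) ^ β * eLpNorm g p logMeasure) := by
        gcongr
    _ = _ := by
        rw [← mul_assoc, ENNReal.ofReal_rpow_of_nonneg (by positivity) hα0,
          ENNReal.ofReal_rpow_of_nonneg (by positivity) hβ0,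
          ← ENNReal.ofReal_mul (by positivity)]
        congr 2
        rw [show C₂ / (t / 2) = 2 * C₂ / t by field_simp, Real.div_rpow (by positivity) ht.le,
          Real.div_rpow (by positivity) hL.le, div_mul_div_comm]

/-! ### Extension by continuity -/

/-- Truncation in space and in height. -/
def truncSet (f : Plane → ℂ) (n : ℕ) : Set Plane := {x | ‖f x‖ ≤ n ∧ ‖x‖ ≤ n}

theorem measurableSet_truncSet {f : Plane → ℂ} (hf : StronglyMeasurable f) (n : ℕ) :
    MeasurableSet (truncSet f n) :=
  (measurableSet_le hf.measurable.norm measurable_const).inter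
    (measurableSet_le measurable_norm measurable_const)

theorem eventually_mem_truncSet (f : Plane → ℂ) (x : Plane) : ∀ᶠ n in atTop, x ∈ truncSet f n := by
  obtain ⟨N, hN⟩ := exists_nat_ge (max ‖f x‖ ‖x‖)
  filter_upwards [eventually_ge_atTop N] with n hn
  have : (N : ℝ) ≤ n := by exact_mod_cast hn
  exact ⟨(le_max_left _ _).trans (hN.trans this), (le_max_right _ _).trans (hN.trans this)⟩

theorem norm_indicator_truncSet_le (f : Plane → ℂ) (n : ℕ) (x : Plane) :
    ‖(truncSet f n).indicator f x‖ ≤ n := by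
  by_cases hx : x ∈ truncSet f n
  · rw [Set.indicator_of_mem hx]
    exact hx.1
  · rw [Set.indicator_of_notMem hx, norm_zero]
    positivity

theorem memLp_indicator_truncSet {f : Plane → ℂ} (hf : StronglyMeasurable f) (n : ℕ) (p : ℝ≥0∞) :
    MemLp ((truncSet f n).indicator f) p extVol := by
  have hA : MeasurableSet (Metric.closedBall (0 : Plane) n) :=
    Metric.isClosed_closedBall.measurableSet
  refine MemLp.of_le (memLp_indicator_const p hA (n : ℝ)
    (Or.inr (isCompact_closedBall (0 : Plane) n).measure_lt_top.ne))
    (hf.indicator (measurableSet_truncSet hf n)).aestronglyMeasurable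
    (Eventually.of_forall fun x => ?_)
  by_cases hx : x ∈ truncSet f n
  · rw [Set.indicator_of_mem hx, Set.indicator_of_mem (by simpa using hx.2)]
    simpa using hx.1
  · rw [Set.indicator_of_notMem hx, norm_zero]
    exact norm_nonneg _

theorem tendsto_eLpNorm_indicator_truncSet {f : Plane → ℂ} (hf : StronglyMeasurable f) {p : ℝ≥0∞}
    (hp : p ≠ 0) (hp' : p ≠ ⊤) (hfp : MemLp f p extVol) :
    Tendsto (fun n => eLpNorm ((truncSet f n).indicator f - f) p extVol) atTop (𝓝 0) := by
  have hpr : 0 < p.toReal := ENNReal.toReal_pos hp hp'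
  have key : Tendsto (fun n => ∫⁻ x, ‖((truncSet f n).indicator f - f) x‖ₑ ^ p.toReal ∂extVol)
      atTop (𝓝 0) := by
    rw [← lintegral_zero (μ := extVol)]
    refine tendsto_lintegral_of_dominated_convergence (fun x => ‖f x‖ₑ ^ p.toReal) ?_ ?_ ?_ ?_
    · intro n
      exact ((hf.indicator (measurableSet_truncSet hf n)).sub hf).enorm.pow_const _
    · refine fun n => Eventually.of_forall fun x => ?_
      beta_reduce
      gcongr
      by_cases hx : x ∈ truncSet f n
      · simp [Set.indicator_of_mem hx]
      · simp [Set.indicator_of_notMem hx]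
    · exact (lintegral_rpow_enorm_lt_top_of_eLpNorm_lt_top hp hp' hfp.2).ne
    · refine Eventually.of_forall fun x => ?_
      refine tendsto_const_nhds.congr' ?_
      filter_upwards [eventually_mem_truncSet f x] with n hn
      simp [Set.indicator_of_mem hn, hpr]
  simp_rw [eLpNorm_eq_lintegral_rpow_enorm_toReal hp hp']
  have := (ENNReal.continuous_rpow_const (y := 1 / p.toReal)).continuousAt.tendsto.comp key
  rw [ENNReal.zero_rpow_of_pos (by positivity)] at this
  exact this

/-- The heat semigroup is a contraction in every `Lᵖ` norm. -/
theorem eLpNorm_heatL2_le {p : ℝ≥0∞} (hp : 1 ≤ p) (hp' : p ≠ ⊤) {t : ℝ} (ht : 0 < t) (g : L2) :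
    eLpNorm (heatL2 t g) p extVol ≤ eLpNorm g p extVol := by
  have hp0 : p ≠ 0 := (zero_lt_one.trans_le hp).ne'
  have hpr : 1 ≤ p.toReal := by simpa using ENNReal.toReal_mono hp' hp
  have hg := Lp.stronglyMeasurable g
  -- The $L^p$ contraction is known for bounded functions only. The truncations converge in $L^2$,
  -- so their images converge almost everywhere along a subsequence and Fatou's lemma applies.
  set G : ℕ → L2 := fun n => (memLp_indicator_truncSet hg n 2).toLp _ with hG
  have hGc : ∀ n, G n =ᵐ[extVol] (truncSet g n).indicator g := fun n =>
    (memLp_indicator_truncSet hg n 2).coeFn_toLp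
  have hGlim : Tendsto G atTop (𝓝 g) := by
    rw [Lp.tendsto_Lp_iff_tendsto_eLpNorm']
    refine (tendsto_eLpNorm_indicator_truncSet hg two_ne_zero ENNReal.ofNat_ne_top
      (Lp.memLp g)).congr fun n => eLpNorm_congr_ae ?_
    exact (hGc n).symm.sub (EventuallyEq.refl _ _)
  have hSlim : Tendsto (fun n => heatL2 t (G n)) atTop (𝓝 (heatL2 t g)) :=
    ((heatL2 t).continuous.tendsto g).comp hGlim
  obtain ⟨ns, -, hae⟩ := exists_subseq_tendsto_ae hSlim
  refine Lp.eLpNorm_le_of_ae_tendsto (Eventually.of_forall fun n => ?_)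
    (fun n => Lp.aestronglyMeasurable (heatL2 t (G (ns n)))) hae
  have hK : ∀ᵐ x ∂extVol, ‖G (ns n) x‖ ≤ (ns n : ℕ) := by
    filter_upwards [hGc (ns n)] with x hx
    rw [hx]
    exact norm_indicator_truncSet_le _ _ _
  calc eLpNorm (heatL2 t (G (ns n))) p extVol ≤ eLpNorm (G (ns n)) p extVol := by
        rw [eLpNorm_eq_lintegral_rpow_enorm_toReal hp0 hp',
          eLpNorm_eq_lintegral_rpow_enorm_toReal hp0 hp']
        gcongr ?_ ^ _
        exact lintegral_rpow_heatL2_le hK hpr ht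
    _ = eLpNorm ((truncSet g (ns n)).indicator g) p extVol := eLpNorm_congr_ae (hGc _)
    _ ≤ _ := eLpNorm_indicator_le _

theorem eLpNorm_heatL2_sub_le {p : ℝ≥0∞} (hp : 1 ≤ p) (hp' : p ≠ ⊤) {t : ℝ} (ht : 0 < t)
    (g g' : L2) :
    eLpNorm (⇑(heatL2 t g) - ⇑(heatL2 t g')) p extVol ≤ eLpNorm (⇑g - ⇑g') p extVol := by
  rw [← eLpNorm_congr_ae (Lp.coeFn_sub (heatL2 t g) (heatL2 t g')),
    ← eLpNorm_congr_ae (Lp.coeFn_sub g g'), ← map_sub]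
  exact eLpNorm_heatL2_le hp hp' ht _

theorem memLp_heatL2 {p : ℝ≥0∞} (hp : 1 ≤ p) (hp' : p ≠ ⊤) {t : ℝ} (ht : 0 < t) {g : L2}
    (hg : MemLp g p extVol) : MemLp (heatL2 t g) p extVol :=
  ⟨Lp.aestronglyMeasurable _, (eLpNorm_heatL2_le hp hp' ht g).trans_lt hg.2⟩

/-- Bounded square integrable approximations of an `Lᵖ` function of the weighted measure. -/
theorem exists_approx {p : ℝ≥0∞} (hp : p ≠ 0) (hp' : p ≠ ⊤) {f : Plane → ℂ}
    (hf : MemLp f p logMeasure) :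
    ∃ G : ℕ → L2, (∀ n, MemLp (G n) p extVol) ∧ (∀ n, ∃ K : ℝ, ∀ᵐ x ∂extVol, ‖G n x‖ ≤ K) ∧
      Tendsto (fun n => eLpNorm (⇑(G n) - f) p extVol) atTop (𝓝 0) ∧
      ∀ n, eLpNorm (G n) p logMeasure ≤ eLpNorm f p logMeasure := by
  -- The truncation sets must be measurable, so $f$ is replaced by a strongly measurable
  -- representative; the weight is at least 1, so it also agrees with $f$ almost everywhere for
  -- `extVol`.
  set f' := hf.1.mk f with hf'
  have hsm : StronglyMeasurable f' := hf.1.stronglyMeasurable_mk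
  have hlog : f =ᵐ[logMeasure] f' := hf.1.ae_eq_mk
  have hext : f =ᵐ[extVol] f' :=
    (Measure.absolutelyContinuous_of_le extVol_le_logMeasure).ae_le hlog
  have hfp : MemLp f' p extVol := (hf.mono_measure extVol_le_logMeasure).ae_eq hext
  have hGc : ∀ n, (memLp_indicator_truncSet hsm n 2).toLp _ =ᵐ[extVol]
      (truncSet f' n).indicator f' := fun n => (memLp_indicator_truncSet hsm n 2).coeFn_toLp
  refine ⟨fun n => (memLp_indicator_truncSet hsm n 2).toLp _, fun n => ?_, fun n => ⟨n, ?_⟩, ?_,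
    fun n => ?_⟩
  · exact (memLp_indicator_truncSet hsm n p).ae_eq (hGc n).symm
  · filter_upwards [hGc n] with x hx
    rw [hx]
    exact norm_indicator_truncSet_le _ _ _
  · refine (tendsto_eLpNorm_indicator_truncSet hsm hp hp' hfp).congr fun n => eLpNorm_congr_ae ?_
    exact (hGc n).symm.sub hext.symm
  · rw [eLpNorm_congr_ae (logMeasure_absolutelyContinuous.ae_le (hGc n)), eLpNorm_congr_ae hlog]
    exact eLpNorm_indicator_le _

/-- By $L^p$ contractivity the images of one approximating sequence are Cauchy, and those of any
other approximating sequence have the same limit. -/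
theorem exists_isHeatFlow {p : ℝ≥0∞} (hp : 1 ≤ p) (hp' : p ≠ ⊤) {f : Plane → ℂ}
    (hf : MemLp f p logMeasure) {t : ℝ} (ht : 0 < t) : ∃ v, IsHeatFlow p t f v := by
  have hp0 : p ≠ 0 := (zero_lt_one.trans_le hp).ne'
  have : Fact (1 ≤ p) := ⟨hp⟩
  have hfe : MemLp f p extVol := hf.mono_measure extVol_le_logMeasure
  obtain ⟨G, hGp, -, hGlim, -⟩ := exists_approx hp0 hp' hf
  set A : ℕ → Lp ℂ p extVol := fun n => (hGp n).toLp _ with hA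
  set B : ℕ → Lp ℂ p extVol := fun n => (memLp_heatL2 hp hp' ht (hGp n)).toLp _ with hB
  have hAc : CauchySeq A := by
    have : Tendsto A atTop (𝓝 (hfe.toLp f)) := by
      rw [Lp.tendsto_Lp_iff_tendsto_eLpNorm']
      refine hGlim.congr fun n => eLpNorm_congr_ae ?_
      exact (hGp n).coeFn_toLp.symm.sub hfe.coeFn_toLp.symm
    exact this.cauchySeq
  have hdist : ∀ m n, dist (B m) (B n) ≤ dist (A m) (A n) := by
    intro m n
    rw [Lp.dist_def, Lp.dist_def]
    refine ENNReal.toReal_mono ?_ ?_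
    · rw [eLpNorm_congr_ae ((hGp m).coeFn_toLp.sub (hGp n).coeFn_toLp)]
      exact ((hGp m).sub (hGp n)).2.ne
    · rw [eLpNorm_congr_ae ((hGp m).coeFn_toLp.sub (hGp n).coeFn_toLp),
        eLpNorm_congr_ae ((memLp_heatL2 hp hp' ht (hGp m)).coeFn_toLp.sub
          (memLp_heatL2 hp hp' ht (hGp n)).coeFn_toLp)]
      exact eLpNorm_heatL2_sub_le hp hp' ht _ _
  have hBc : CauchySeq B := by
    rw [Metric.cauchySeq_iff] at hAc ⊢
    intro ε hε
    obtain ⟨N, hN⟩ := hAc ε hε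
    exact ⟨N, fun m hm n hn => (hdist m n).trans_lt (hN m hm n hn)⟩
  obtain ⟨v, hv⟩ := cauchySeq_tendsto_of_complete hBc
  rw [Lp.tendsto_Lp_iff_tendsto_eLpNorm'] at hv
  have hv' : Tendsto (fun n => eLpNorm (⇑(heatL2 t (G n)) - ⇑v) p extVol) atTop (𝓝 0) := by
    refine hv.congr fun n => eLpNorm_congr_ae ?_
    exact (memLp_heatL2 hp hp' ht (hGp n)).coeFn_toLp.sub (EventuallyEq.refl _ _)
  refine ⟨v, hfe, Lp.memLp v, fun g hg hglim => ?_⟩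
  have hsum : Tendsto (fun n => eLpNorm (⇑(g n) - f) p extVol + eLpNorm (⇑(G n) - f) p extVol +
      eLpNorm (⇑(heatL2 t (G n)) - ⇑v) p extVol) atTop (𝓝 0) := by
    simpa using (hglim.add hGlim).add hv'
  refine tendsto_of_tendsto_of_tendsto_of_le_of_le tendsto_const_nhds hsum (fun _ => zero_le)
    fun n => ?_
  have m1 := Lp.aestronglyMeasurable (heatL2 t (g n))
  have m2 := Lp.aestronglyMeasurable (heatL2 t (G n))
  calc eLpNorm (⇑(heatL2 t (g n)) - ⇑v) p extVol
      = eLpNorm ((⇑(heatL2 t (g n)) - ⇑(heatL2 t (G n))) + (⇑(heatL2 t (G n)) - ⇑v)) p extVol := by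
        rw [sub_add_sub_cancel]
    _ ≤ eLpNorm (⇑(heatL2 t (g n)) - ⇑(heatL2 t (G n))) p extVol +
          eLpNorm (⇑(heatL2 t (G n)) - ⇑v) p extVol :=
        eLpNorm_add_le (m1.sub m2) (m2.sub (Lp.aestronglyMeasurable v)) hp
    _ ≤ eLpNorm (⇑(g n) - ⇑(G n)) p extVol + eLpNorm (⇑(heatL2 t (G n)) - ⇑v) p extVol := by
        gcongr
        exact eLpNorm_heatL2_sub_le hp hp' ht _ _
    _ ≤ _ := by
        gcongr
        calc eLpNorm (⇑(g n) - ⇑(G n)) p extVol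
            = eLpNorm ((⇑(g n) - f) - (⇑(G n) - f)) p extVol := by
              rw [sub_sub_sub_cancel_right]
          _ ≤ _ := eLpNorm_sub_le ((Lp.aestronglyMeasurable _).sub hfe.1)
              ((Lp.aestronglyMeasurable _).sub hfe.1) hp

/-- The definition of the flow is applied to bounded approximants, whose images converge almost
everywhere along a subsequence; Fatou's lemma in $L^q$ includes $q=\infty$. The weighted norms of
the approximants need only stay below that of $f$. -/
theorem eLpNorm_le_of_isHeatFlow {p q c : ℝ≥0∞} (hp : 1 ≤ p) (hp' : p ≠ ⊤) {f v : Plane → ℂ}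
    (hf : MemLp f p logMeasure) {t : ℝ}
    (hc : ∀ (g : L2) (K : ℝ), (∀ᵐ x ∂extVol, ‖g x‖ ≤ K) →
      eLpNorm (heatL2 t g) q extVol ≤ c * eLpNorm g p logMeasure)
    (hv : IsHeatFlow p t f v) : eLpNorm v q extVol ≤ c * eLpNorm f p logMeasure := by
  have hp0 : p ≠ 0 := (zero_lt_one.trans_le hp).ne'
  obtain ⟨G, hGp, hGb, hGlim, hGle⟩ := exists_approx hp0 hp' hf
  have hlim := hv.2.2 G hGp hGlim
  obtain ⟨ns, -, hae⟩ := (tendstoInMeasure_of_tendsto_eLpNorm hp0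
    (fun n => Lp.aestronglyMeasurable (heatL2 t (G n))) hv.2.1.1 hlim).exists_seq_tendsto_ae
  refine Lp.eLpNorm_le_of_ae_tendsto (Eventually.of_forall fun n => ?_)
    (fun n => Lp.aestronglyMeasurable (heatL2 t (G (ns n)))) hae
  obtain ⟨K, hK⟩ := hGb (ns n)
  refine (hc _ K hK).trans ?_
  gcongr
  exact hGle _

end ExteriorHeat

end

theorem lemmaA3 (p q : ℝ≥0∞) (hp : 1 ≤ p) (hp' : p ≠ ⊤) (hpq : p ≤ q) :
    ∃ C : ℝ, 0 < C ∧
      ∀ f : ExteriorHeat.Plane → ℂ, MemLp f p ExteriorHeat.logMeasure →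
        ∀ t : ℝ, 0 < t →
          (∃ v, ExteriorHeat.IsHeatFlow p t f v) ∧
          ∀ v, ExteriorHeat.IsHeatFlow p t f v →
            MemLp v q ExteriorHeat.extVol ∧
            eLpNorm v q ExteriorHeat.extVol ≤
              ENNReal.ofReal
                (C / (t ^ ((1 / p).toReal - (1 / q).toReal) *
                  (1 + Real.log (1 + t)) ^ (1 / p).toReal)) *
                eLpNorm f p ExteriorHeat.logMeasure := by
  obtain ⟨C, hC, h⟩ := ExteriorHeat.exists_eLpNorm_heatL2_le p q hp hp' hpq
  refine ⟨C, hC, fun f hf t ht => ⟨ExteriorHeat.exists_isHeatFlow hp hp' hf ht, fun v hv => ?_⟩⟩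
  have hle := ExteriorHeat.eLpNorm_le_of_isHeatFlow hp hp' hf (fun g K hK => h g K hK t ht) hv
  exact ⟨⟨hv.2.1.1, hle.trans_lt (ENNReal.mul_lt_top ENNReal.ofReal_lt_top hf.2)⟩, hle⟩
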